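/- Let $G$ be a (finite-dimensional real) Lie group with Lie algebra $\mathfrak g$, let $K\le G$ be a compact subgroup with Lie algebra $\mathfrak k$, let $M=G/K$ with projection $\pi:G\to M$, and let $G$ carry a left-invariant Riemannian metric that is also invariant under right translations by elements of $K$; $d_G$ denotes its geodesic distance ($d_G=\infty$ between different components). Let $\mathfrak k^\perp$ be the orthogonal complement of $\mathfrak k$ in $\mathfrak g$. Write $y^{-1}vy=\mathrm{Ad}(y^{-1})v$ for $v\in\mathfrak g$, and let $K$ act on the Riemannian Hilbert manifold $X=G\times L^2([0,1],\mathfrak k^\perp)$ (product metric) from the right by $(a,q)*y=(ay,\,y^{-1}qy)$; this action is free and isometric. Let $AC([0,1],M)$ be the set of absolutely continuous curves $\beta:[0,1]\to M$. A horizontal lift of $\beta$ is an absolutely continuous $\alpha:[0,1]\to G$ with $\pi\circ\alpha=\beta$ and $L_{\alpha(t)^{-1}}\alpha'(t)\in\mathfrak k^\perp$ for almost every $t$. Put $Q(\alpha)=(\alpha(0),q)$ with $q(t)=L_{\alpha(t)^{-1}}\alpha'(t)/\sqrt{\|\alpha'(t)\|}$, and $q(t)=0$ where $\alpha'(t)=0$.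 A point $x\in X$ is said to represent $\beta$ if $x=Q(\alpha)$ for a horizontal lift $\alpha$ of $\beta$. The points that represent $\beta$ form one $K$-orbit, and this identifies $AC([0,1],M)$ with $X/K$. Equip $AC([0,1],M)$ with the smooth structure and the Riemannian metric of $X/K$ for which $X\to X/K$ is a Riemannian submersion: for every $x$ representing $\beta$, the tangent space at $\beta$ is isometrically the orthogonal complement in $T_xX$ of the tangent space of the orbit $x*K$. For $\beta_1,\beta_2$ with horizontal lifts $\alpha_1,\alpha_2$ and $Q(\alpha_i)=(\alpha_i(0),q_i)$, let $$d(\beta_1,\beta_2)=\inf_{y\in K}\Bigl(d_G(\alpha_1(0),\alpha_2(0)y)^2+\|q_1-y^{-1}q_2y\|_{L^2}^2\Bigr)^{1/2}\in[0,\infty],$$ the distance between the corresponding $K$-orbits. Let $G$ act on $AC([0,1],M)$ by $(g\beta)(t)=g\,\beta(t)$, and let the group $\Gamma=\mathrm{Diff}^+([0,1])$ of smooth orientation-preserving diffeomorphisms of $[0,1]$ act by $\beta\mapsto\beta\circ\gamma$. Then: 1. For all $g\in G$ and $\gamma\in\Gamma$, the maps $\beta\mapsto g\beta$ and $\beta\mapsto\beta\circ\gamma$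 preserve the Riemannian metric of $AC([0,1],M)$: at each $\beta$ they have a differential (which carries velocities of curves through $\beta$ to velocities of the image curves), and it is a linear isometry of the tangent space at $\beta$ onto the tangent space at the image of $\beta$. 2. $d(\beta_1,\beta_2)$ does not depend on the choice of the horizontal lifts $\alpha_1,\alpha_2$, and $d(g\beta_1,g\beta_2)=d(\beta_1,\beta_2)=d(\beta_1\circ\gamma,\beta_2\circ\gamma)$ for all $\beta_1,\beta_2\in AC([0,1],M)$, $g\in G$, $\gamma\in\Gamma$. The geodesic distance of the Riemannian metric on $AC([0,1],M)$ (infimum of the lengths of $C^1$ curves) is invariant under $G$ and $\Gamma$ in the same way. -/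

import Mathlib

open scoped Manifold ContDiff ENNReal Bundle Topology
open MeasureTheory Bundle

noncomputable section

namespace SRV

section Congr

variable {E : Type*} [NormedAddCommGroup E] [NormedSpace ℝ E]
  {H : Type*} [TopologicalSpace H] (I : ModelWithCorners ℝ E H)
  {G : Type*} [TopologicalSpace G] [ChartedSpace H G]

lemma mfderiv_congr_base {f : G → G} {a b : G} (h : a = b) (v : E) :
    (mfderiv I I f a v : E) = (mfderiv I I f b v : E) := by
  subst h; rfl

variable [RiemannianBundle (fun x : G ↦ TangentSpace I x)]

/-- Shortcut: the tangent spaces of `G` are normed by the Riemannian metric of `G`. -/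
instance instNormedTangent (a : G) : NormedAddCommGroup (TangentSpace I a) :=
  inferInstanceAs (NormedAddCommGroup ((fun x : G ↦ TangentSpace I x) a))

/-- Shortcut: the inner product of the tangent spaces of `G` given by its Riemannian metric. -/
instance instInnerTangent (a : G) : InnerProductSpace ℝ (TangentSpace I a) :=
  inferInstanceAs (InnerProductSpace ℝ ((fun x : G ↦ TangentSpace I x) a))

lemma inner_congr_base {a b : G} (h : a = b) (u v : E) :
    inner ℝ (show TangentSpace I a from u) (show TangentSpace I a from v)
      = inner ℝ (show TangentSpace I b from u) (show TangentSpace I b from v) := by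
  subst h; rfl

end Congr

section Metric

variable {E : Type*} [NormedAddCommGroup E] [NormedSpace ℝ E]
  {H : Type*} [TopologicalSpace H] (I : ModelWithCorners ℝ E H)
  {G : Type*} [TopologicalSpace G] [ChartedSpace H G] [Group G]

/-- The Riemannian metric of the Lie group `G` is left invariant, and it is also invariant under
right translations by elements of the subgroup `K`. -/
class InvariantMetric [RiemannianBundle (fun x : G ↦ TangentSpace I x)] (K : Subgroup G) :
    Prop where
  left : ∀ (g a : G) (u v : TangentSpace I a),
    inner ℝ (mfderiv I I (fun z : G ↦ g * z) a u) (mfderiv I I (fun z : G ↦ g * z) a v)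
      = inner ℝ u v
  right : ∀ k ∈ K, ∀ (a : G) (u v : TangentSpace I a),
    inner ℝ (mfderiv I I (fun z : G ↦ z * k) a u) (mfderiv I I (fun z : G ↦ z * k) a v)
      = inner ℝ u v

/-- The curve `c` passes through `a` at time `s`, with velocity `v`, a tangent vector at `a`. -/
def HasVelocity (c : ℝ → G) (s : ℝ) {a : G} (v : TangentSpace I a) : Prop :=
  c s = a ∧ HasMFDerivAt 𝓘(ℝ, ℝ) I c s
    (ContinuousLinearMap.toSpanSingleton ℝ (show TangentSpace I (c s) from v))

/-- The Lie algebra `𝔨` of `K`, i.e. the tangent space of `K` at the identity: it consists of the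
velocities at `1` of the curves in `K` (these already form a linear subspace of `𝔤`). -/
def lieAlg (K : Subgroup G) : Submodule ℝ (GroupLieAlgebra I G) :=
  Submodule.span ℝ {v | ∃ c : ℝ → G, (∀ s, c s ∈ K) ∧ HasVelocity I c 0 (a := 1) v}

/-- The differential at the identity of the conjugation `z ↦ y * z * y⁻¹`; for `v` in `𝔤` one
writes `y v y⁻¹` for `Ad y v`. -/
def Ad (y : G) : GroupLieAlgebra I G →L[ℝ] GroupLieAlgebra I G :=
  show TangentSpace I (1 : G) →L[ℝ] TangentSpace I (y * 1 * y⁻¹) from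
    mfderiv I I (fun z : G ↦ y * z * y⁻¹) 1

variable [LieGroup I ∞ G]

lemma mdiff_conj (y z : G) : MDifferentiableAt I I (fun z : G ↦ y * z * y⁻¹) z := by
  have h : ContMDiff I I ∞ (fun z : G ↦ y * z * y⁻¹) :=
    (contMDiff_mul_right (I := I) (n := ∞) (a := y⁻¹)).comp
      (contMDiff_mul_left (I := I) (n := ∞) (a := y))
  exact h.mdifferentiableAt (by simp)

lemma Ad_mem_lieAlg {K : Subgroup G} {y : G} (hy : y ∈ K) {v : GroupLieAlgebra I G}
    (hv : v ∈ lieAlg I K) : Ad I y v ∈ lieAlg I K := by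
  have key : lieAlg I K ≤ (lieAlg I K).comap (Ad I y : GroupLieAlgebra I G →ₗ[ℝ] _) := by
    refine Submodule.span_le.2 ?_
    rintro v ⟨c, hcK, hc0, hc⟩
    refine Submodule.subset_span ⟨fun s ↦ y * c s * y⁻¹,
      fun s ↦ K.mul_mem (K.mul_mem hy (hcK s)) (K.inv_mem hy), by simp [hc0], ?_⟩
    have h := (mdiff_conj I y (c 0)).hasMFDerivAt.comp 0 hc
    have e : ContinuousLinearMap.toSpanSingleton ℝ (show E from Ad I y v) =
        (show E →L[ℝ] E from mfderiv I I (fun z : G ↦ y * z * y⁻¹) (c 0)).comp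
          (ContinuousLinearMap.toSpanSingleton ℝ (show E from v)) := by
      refine ContinuousLinearMap.ext_ring ?_
      have e1 := mfderiv_congr_base I (f := fun z : G ↦ y * z * y⁻¹) hc0 v
      change (1 : ℝ) • (show E from Ad I y v) =
        (show E →L[ℝ] E from mfderiv I I (fun z : G ↦ y * z * y⁻¹) (c 0)) ((1 : ℝ) • (show E from v))
      rw [one_smul, one_smul]
      exact e1.symm
    exact h.congr_mfderiv e.symm
  exact key hv

lemma Ad_Ad_inv (y : G) (v : GroupLieAlgebra I G) : Ad I y (Ad I y⁻¹ v) = v := by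
  have h := (mdiff_conj I y (y⁻¹ * 1 * y⁻¹⁻¹)).hasMFDerivAt.comp 1
    (mdiff_conj I y⁻¹ 1).hasMFDerivAt
  have h2 : ((fun z : G ↦ y * z * y⁻¹) ∘ fun z ↦ y⁻¹ * z * y⁻¹⁻¹) = id := by
    ext z; simp [mul_assoc]
  rw [h2] at h
  have h3 := hasMFDerivAt_unique h (hasMFDerivAt_id (I := I) (1 : G))
  have h4 := congrArg (fun L : E →L[ℝ] E ↦ L v) h3
  refine Eq.trans ?_ h4
  exact mfderiv_congr_base I (f := fun z : G ↦ y * z * y⁻¹) (by simp) _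

variable [RiemannianBundle (fun x : G ↦ TangentSpace I x)]

lemma inner_Ad {K : Subgroup G} [hK : InvariantMetric I K] {y : G} (hy : y ∈ K)
    (u v : GroupLieAlgebra I G) : inner ℝ (Ad I y u) (Ad I y v) = inner ℝ u v := by
  have hl : MDifferentiableAt I I (fun z : G ↦ y * z) 1 :=
    (contMDiff_mul_left (I := I) (n := ∞)).mdifferentiableAt (by simp)
  have hr : MDifferentiableAt I I (fun z : G ↦ z * y⁻¹) (y * 1) :=
    (contMDiff_mul_right (I := I) (n := ∞)).mdifferentiableAt (by simp)
  have h := mfderiv_comp (1 : G) hr hl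
  have h' : ∀ w : GroupLieAlgebra I G, Ad I y w =
      (mfderiv I I (fun z : G ↦ z * y⁻¹) (y * 1) (mfderiv I I (fun z : G ↦ y * z) 1 w) : E) :=
    fun w ↦ congrArg (fun L : E →L[ℝ] E ↦ L w) h
  have e := inner_congr_base I (show (1 : G) = y * 1 * y⁻¹ by simp) (Ad I y u) (Ad I y v)
  refine e.trans ?_
  rw [h' u, h' v]
  exact (hK.right _ (K.inv_mem hy) _ _ _).trans (hK.left _ _ _ _)

variable (K : Subgroup G)

/-- The orthogonal complement `𝔨^⊥` of the Lie algebra of `K` in `𝔤`. -/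
abbrev perp : Submodule ℝ (GroupLieAlgebra I G) := (lieAlg I K)ᗮ

variable [InvariantMetric I K]

variable {K} in
lemma Ad_mem_perp {y : G} (hy : y ∈ K) {v : GroupLieAlgebra I G}
    (hv : v ∈ perp I K) : Ad I y v ∈ perp I K := by
  rw [Submodule.mem_orthogonal] at hv ⊢
  intro u hu
  rw [← Ad_Ad_inv I y u, inner_Ad I hy]
  exact hv _ (Ad_mem_lieAlg I (K.inv_mem hy) hu)

/-- The map `v ↦ y⁻¹ v y` on `𝔨^⊥`, for `y` in `K`. -/
def conjPerp (y : K) : perp I K →L[ℝ] perp I K :=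
  (Ad I (y : G)⁻¹).restrict (fun _ hv ↦ Ad_mem_perp I (K.inv_mem y.2) hv)

end Metric

section Curves

variable {E : Type*} [NormedAddCommGroup E] [NormedSpace ℝ E]
  {H : Type*} [TopologicalSpace H] (I : ModelWithCorners ℝ E H)
  {G : Type*} [TopologicalSpace G] [ChartedSpace H G] [Group G]

/-- Absolute continuity of a real function on `[0,1]`. -/
def IsACReal (f : unitInterval → ℝ) : Prop :=
  AbsolutelyContinuousOnInterval (Set.IccExtend zero_le_one f) 0 1

/-- Absolute continuity of a curve in the manifold `G`: its composition with every smooth real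
function on `G` is absolutely continuous. -/
def IsACGroup (α : unitInterval → G) : Prop :=
  ∀ f : G → ℝ, ContMDiff I 𝓘(ℝ, ℝ) ∞ f → IsACReal (f ∘ α)

/-- Absolute continuity of a curve in the homogeneous space `M = G ⧸ K`: its composition with every
smooth real function on `M` is absolutely continuous. A function on `G ⧸ K` is smooth if and only
if its pullback to `G` is smooth, since the projection is a surjective submersion. -/
def IsACQuotient (K : Subgroup G) (β : unitInterval → G ⧸ K) : Prop :=
  ∀ f : G ⧸ K → ℝ, ContMDiff I 𝓘(ℝ, ℝ) ∞ (f ∘ (QuotientGroup.mk : G → G ⧸ K)) → IsACReal (f ∘ β)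

/-- The space `AC([0,1], M)` for `M = G ⧸ K`. -/
structure ACCurve (K : Subgroup G) where
  toFun : unitInterval → G ⧸ K
  ac : IsACQuotient I K toFun

/-- The group `Γ = Diff⁺([0,1])` of smooth orientation preserving diffeomorphisms of `[0,1]`. -/
def Reparam : Type :=
  {γ : Diffeomorph (𝓡∂ 1) (𝓡∂ 1) unitInterval unitInterval ∞ // StrictMono γ}

lemma IsACReal.comp_reparam {f : unitInterval → ℝ} (hf : IsACReal f) (γ : Reparam) :
    IsACReal (f ∘ γ.1) := by
  set φ : ℝ → ℝ := fun s ↦ (γ.1 (Set.projIcc 0 1 zero_le_one s) : ℝ) with hφ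
  have hmono : Monotone φ := fun s t hst ↦ γ.2.monotone (Set.monotone_projIcc _ hst)
  have hmem : ∀ s, φ s ∈ Set.uIcc (0 : ℝ) 1 := fun s ↦ by
    rw [Set.uIcc_of_le zero_le_one]; exact (γ.1 _).2
  have hext : Set.IccExtend zero_le_one (f ∘ γ.1) = Set.IccExtend zero_le_one f ∘ φ := by
    ext s; simp [Set.IccExtend, hφ]
  have hlip : ∃ L, LipschitzOnWith L φ (Set.Icc 0 1) := by
    have h1 : ContMDiffOn 𝓘(ℝ, ℝ) 𝓘(ℝ, ℝ) 1 φ (Set.Icc 0 1) :=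
      (contMDiff_subtypeVal_Icc.comp (γ.1.contMDiff.of_le (by simp))).comp_contMDiffOn
        contMDiffOn_projIcc
    exact (contMDiffOn_iff_contDiffOn.1 h1).exists_lipschitzOnWith one_ne_zero
      (convex_Icc 0 1) isCompact_Icc
  obtain ⟨L, hL⟩ := hlip
  unfold IsACReal at hf ⊢
  rw [hext]
  rw [absolutelyContinuousOnInterval_iff] at hf ⊢
  intro ε hε
  obtain ⟨δ, hδ, h⟩ := hf ε hε
  refine ⟨δ / (L + 1), by positivity, fun J hJ hJδ ↦ ?_⟩
  refine h (J.1, fun i ↦ (φ (J.2 i).1, φ (J.2 i).2)) ⟨fun i _ ↦ ⟨hmem _, hmem _⟩, ?_⟩ ?_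
  · intro i hi j hj hij
    have hd := hJ.2 hi hj hij
    simp only [Function.onFun] at hd ⊢
    rw [Set.disjoint_left] at hd ⊢
    intro y hy hy'
    simp only [Set.uIoc, Set.mem_Ioc, ← hmono.map_min, ← hmono.map_max] at hy hy' hd
    have h1 := hmono.reflect_lt (hy.1.trans_le hy.2)
    have h2 := hmono.reflect_lt (hy.1.trans_le hy'.2)
    have h3 := hmono.reflect_lt (hy'.1.trans_le hy.2)
    have h4 := hmono.reflect_lt (hy'.1.trans_le hy'.2)
    exact hd (a := min (max (J.2 i).1 (J.2 i).2) (max (J.2 j).1 (J.2 j).2))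
      ⟨lt_min h1 h2, min_le_left _ _⟩ ⟨lt_min h3 h4, min_le_right _ _⟩
  · have hL1 : (0 : ℝ) < L + 1 := by positivity
    calc ∑ i ∈ Finset.range J.1, dist (φ (J.2 i).1) (φ (J.2 i).2)
        ≤ ∑ i ∈ Finset.range J.1, (L + 1) * dist (J.2 i).1 (J.2 i).2 := by
          refine Finset.sum_le_sum fun i hi ↦ ?_
          have hm := hJ.1 i hi
          rw [Set.uIcc_of_le zero_le_one] at hm
          refine (hL.dist_le_mul _ hm.1 _ hm.2).trans ?_
          gcongr
          linarith
      _ = (L + 1) * ∑ i ∈ Finset.range J.1, dist (J.2 i).1 (J.2 i).2 := by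
          rw [Finset.mul_sum]
      _ < δ := by
          rw [lt_div_iff₀ hL1] at hJδ
          linarith

variable {I}

/-- The action of `γ` in `Γ` on `AC([0,1], M)` by composition, `β ↦ β ∘ γ`. -/
def ACCurve.reparam {K : Subgroup G} (γ : Reparam) (β : ACCurve I K) : ACCurve I K where
  toFun := β.toFun ∘ γ.1
  ac f hf := (β.ac f hf).comp_reparam γ

/-- The action of `g` in `G` on `AC([0,1], M)` by left translation, `(g β)(t) = g β(t)`. -/
def ACCurve.leftMul [LieGroup I ∞ G] {K : Subgroup G} (g : G) (β : ACCurve I K) : ACCurve I K where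
  toFun t := g • β.toFun t
  ac f hf := β.ac (fun p ↦ f (g • p))
    (hf.comp (contMDiff_mul_left (I := I) (n := ∞) (a := g)))

end Curves

section Transform

variable {E : Type*} [NormedAddCommGroup E] [NormedSpace ℝ E] [FiniteDimensional ℝ E]
  {H : Type*} [TopologicalSpace H] (I : ModelWithCorners ℝ E H)
  {G : Type*} [TopologicalSpace G] [ChartedSpace H G] [Group G]

/-- The derivative `α'(t)` of a curve `α : [0,1] → G` (it is zero where `α` is not
differentiable). -/
def curveDeriv (α : unitInterval → G) (t : unitInterval) : TangentSpace I (α t) :=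
  show TangentSpace I (Set.IccExtend zero_le_one α t) from
    mfderiv 𝓘(ℝ, ℝ) I (Set.IccExtend zero_le_one α) (t : ℝ) (1 : ℝ)

/-- The left translate `L_{α(t)⁻¹} α'(t)` of the derivative, an element of `𝔤`. -/
def leftDeriv (α : unitInterval → G) (t : unitInterval) : GroupLieAlgebra I G :=
  show TangentSpace I ((α t)⁻¹ * α t) from
    mfderiv I I (fun z : G ↦ (α t)⁻¹ * z) (α t) (curveDeriv I α t)

variable [LieGroup I ∞ G] [RiemannianBundle (fun x : G ↦ TangentSpace I x)]

/-- The square root velocity function `q(t) = L_{α(t)⁻¹} α'(t) / √‖α'(t)‖`, which is zero where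
`α'(t) = 0`. -/
def srv (α : unitInterval → G) (t : unitInterval) : GroupLieAlgebra I G :=
  (√‖curveDeriv I α t‖)⁻¹ • leftDeriv I α t

variable (K : Subgroup G)

/-- `α` is a horizontal lift of `β`: it is an absolutely continuous curve in `G` which is almost
everywhere orthogonal to the cosets of `K`, and which projects to `β`. -/
structure IsHorizontalLift (α : unitInterval → G) (β : unitInterval → G ⧸ K) : Prop where
  ac : IsACGroup I α
  proj : ∀ t, (α t : G ⧸ K) = β t
  horizontal : ∀ᵐ t, leftDeriv I α t ∈ perp I K

/-- The Hilbert space `L²([0,1], 𝔨^⊥)`. -/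
abbrev L2Perp : Type _ := Lp (perp I K) 2 (volume : Measure unitInterval)

/-- The Hilbert manifold `G × L²([0,1], 𝔨^⊥)`. -/
abbrev Total : Type _ := G × L2Perp I K

variable {I K}

/-- The point `x = (a, q)` of `G × L²([0,1], 𝔨^⊥)` represents the curve `β` in `M`: for some
horizontal lift `α` of `β` one has `a = α(0)` and `q` is the square root velocity function of `α`.
This is the relation given by the bijection `(G × L²([0,1], 𝔨^⊥)) / K → AC([0,1], M)`. -/
def Represents (x : Total I K) (β : ACCurve I K) : Prop :=
  ∃ α : unitInterval → G, IsHorizontalLift I K α β.toFun ∧ x.1 = α 0 ∧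
    ∀ᵐ t, (x.2 t : GroupLieAlgebra I G) = srv I α t

/-- The tangent space `T_a G × L²([0,1], 𝔨^⊥)` of `G × L²([0,1], 𝔨^⊥)` at `x = (a, q)`, with the
inner product given by the product Riemannian metric. -/
abbrev TotalTangent (x : Total I K) : Type _ := WithLp 2 (TangentSpace I x.1 × L2Perp I K)

/-- The curve `c` in `G × L²([0,1], 𝔨^⊥)` passes through `x` at time `s` with velocity `u`. -/
def HasTotalVelocity (c : ℝ → Total I K) (s : ℝ) {x : Total I K} (u : TotalTangent x) : Prop :=
  HasVelocity I (fun r ↦ (c r).1) s u.fst ∧ (c s).2 = x.2 ∧ HasDerivAt (fun r ↦ (c r).2) u.snd s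

variable [InvariantMetric I K]

/-- The right action `(a, q) * y = (a y, y⁻¹ q y)` of `K` on `G × L²([0,1], 𝔨^⊥)`. -/
def act (x : Total I K) (y : K) : Total I K := (x.1 * y, (conjPerp I K y).compLp x.2)

/-- The vertical space at `x`, i.e. the tangent space at `x` of the orbit of `x` under `K`: it
consists of the velocities at `x` of the curves in the orbit (these already form a linear
subspace). -/
def vertical (x : Total I K) : Submodule ℝ (TotalTangent x) :=
  Submodule.span ℝ {u | ∃ y : ℝ → K, HasTotalVelocity (fun s ↦ act x (y s)) 0 (x := x) u}

/-- The horizontal space at `x`, the orthogonal complement of the vertical space. By definition of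
the Riemannian metric on the quotient by `K`, the differential of the quotient map is a linear
isometry from the horizontal space at `x` onto the tangent space of the quotient at the orbit of
`x`. If `x` represents `β`, the horizontal space at `x` with its inner product is thus the tangent
space of `AC([0,1], M)` at `β` with its Riemannian metric. -/
abbrev horizontal (x : Total I K) : Submodule ℝ (TotalTangent x) := (vertical x)ᗮ

instance instCompleteTangent (a : G) : CompleteSpace (TangentSpace I a) :=
  haveI : FiniteDimensional ℝ (TangentSpace I a) := inferInstanceAs (FiniteDimensional ℝ E)
  FiniteDimensional.complete ℝ _

/-- The horizontal part of the tangent vector `u`. -/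
def horPart {x : Total I K} (u : TotalTangent x) : horizontal x :=
  haveI : (horizontal x).HasOrthogonalProjection :=
    haveI : CompleteSpace (horizontal x) := Submodule.instOrthogonalCompleteSpace (vertical x)
    Submodule.HasOrthogonalProjection.ofCompleteSpace (𝕜 := ℝ) (horizontal x)
  Submodule.orthogonalProjectionOnto (𝕜 := ℝ) (horizontal x) u

/-- The curve `b` in `AC([0,1], M)`, with `b(0)` represented by `x`, has at time `0` the velocity
`v`, a tangent vector at `b(0)`: near time `0`, `b` has a lift `c` to `G × L²([0,1], 𝔨^⊥)` that
starts at `x`, is differentiable at time `0`, and whose velocity has horizontal part `v`. -/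
def HasCurveVelocity (b : ℝ → ACCurve I K) (x : Total I K) (v : horizontal x) : Prop :=
  ∃ (c : ℝ → Total I K) (u : TotalTangent x), (∀ᶠ s in 𝓝 0, Represents (c s) (b s)) ∧
    HasTotalVelocity c 0 u ∧ horPart u = v

/-- The map `F` from `AC([0,1], M)` to itself preserves the Riemannian metric: at every `β` it has a
differential `D`, which maps the velocity of every curve through `β` to the velocity of its image
under `F`, and `D` is a linear isometry from the tangent space at `β` onto the tangent space at
`F(β)`; these are the horizontal spaces at arbitrary points representing `β` and `F(β)`. -/
def PreservesMetric (F : ACCurve I K → ACCurve I K) : Prop :=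
  ∀ (β : ACCurve I K) (x x' : Total I K), Represents x β → Represents x' (F β) →
    ∃ D : horizontal x ≃ₗᵢ[ℝ] horizontal x', ∀ (b : ℝ → ACCurve I K) (v : horizontal x),
      b 0 = β → HasCurveVelocity b x v → HasCurveVelocity (fun s ↦ F (b s)) x' (D v)

/-- `inf_{y ∈ K} (d²(a₁, a₂ y) + ‖q₁ - y⁻¹ q₂ y‖²)^{1/2}`, where `d` is the geodesic distance on `G`,
which is infinite between different connected components. -/
def orbitDist (x₁ x₂ : Total I K) : ℝ≥0∞ :=
  ⨅ y : K, (Manifold.riemannianEDist I x₁.1 (act x₂ y).1 ^ 2 + ‖x₁.2 - (act x₂ y).2‖ₑ ^ 2) ^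
    (1 / 2 : ℝ)

/-- The distance on `AC([0,1], M)` induced from the distance on `G × L²([0,1], 𝔨^⊥)`: the distance
of the `K`-orbits that correspond to the two curves. -/
def curveDist (β₁ β₂ : ACCurve I K) : ℝ≥0∞ :=
  ⨅ (x₁ : Total I K) (_ : Represents x₁ β₁) (x₂ : Total I K) (_ : Represents x₂ β₂),
    orbitDist x₁ x₂

/-- The velocity at time `s` of a curve in `G × L²([0,1], 𝔨^⊥)` parametrized by `[0,1]`. -/
def totalVelocity (c : ℝ → Total I K) (s : ℝ) : TotalTangent (c s) :=
  WithLp.toLp 2 (mfderivWithin 𝓘(ℝ, ℝ) I (fun r ↦ (c r).1) (Set.Icc 0 1) s (1 : ℝ),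
    derivWithin (fun r ↦ (c r).2) (Set.Icc 0 1) s)

/-- The geodesic distance of the Riemannian metric on `AC([0,1], M)`: the infimum of the lengths of
the `C¹` curves from `β₁` to `β₂`. A `C¹` curve in the quotient by `K` is the image of a `C¹` curve
in `G × L²([0,1], 𝔨^⊥)`, and its speed is the norm of the horizontal part of the velocity of the
latter. -/
def geodesicDist (β₁ β₂ : ACCurve I K) : ℝ≥0∞ :=
  ⨅ (c : ℝ → Total I K) (_ : ContMDiffOn 𝓘(ℝ, ℝ) I 1 (fun s ↦ (c s).1) (Set.Icc 0 1))
    (_ : ContDiffOn ℝ 1 (fun s ↦ (c s).2) (Set.Icc 0 1))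
    (_ : Represents (c 0) β₁) (_ : Represents (c 1) β₂),
    ∫⁻ s in Set.Icc (0 : ℝ) 1, ‖horPart (totalVelocity c s)‖ₑ

end Transform
end SRV

end

noncomputable section

namespace SRV

section Translation

variable {E : Type*} [NormedAddCommGroup E] [NormedSpace ℝ E]
  {H : Type*} [TopologicalSpace H] (I : ModelWithCorners ℝ E H)
  {G : Type*} [TopologicalSpace G] [ChartedSpace H G] [Group G] [LieGroup I ∞ G]

lemma contMDiff_translate (g k : G) : ContMDiff I I ∞ (fun z : G ↦ g * z * k) :=
  (contMDiff_mul_right (I := I) (n := ∞) (a := k)).comp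
    (contMDiff_mul_left (I := I) (n := ∞) (a := g))

lemma mdifferentiableAt_translate (g k a : G) :
    MDifferentiableAt I I (fun z : G ↦ g * z * k) a :=
  (contMDiff_translate I g k).mdifferentiableAt (by simp)

lemma mdifferentiableAt_mul_left (g a : G) : MDifferentiableAt I I (fun z : G ↦ g * z) a :=
  (contMDiff_mul_left (I := I) (n := ∞)).mdifferentiableAt (by simp)

lemma mdifferentiableAt_mul_right (k a : G) : MDifferentiableAt I I (fun z : G ↦ z * k) a :=
  (contMDiff_mul_right (I := I) (n := ∞)).mdifferentiableAt (by simp)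

omit [Group G] [LieGroup I ∞ G] in
/-- Chain rule, for vectors regarded as elements of the model space. -/
lemma mfderiv_comp_model {f h : G → G} {a b : G} (hb : f a = b)
    (hh : MDifferentiableAt I I h b) (hf : MDifferentiableAt I I f a) (v : E) :
    (mfderiv I I (fun z ↦ h (f z)) a v : E) = mfderiv I I h b (mfderiv I I f a v : E) := by
  subst hb
  exact congrArg (fun L : E →L[ℝ] E ↦ L v) (mfderiv_comp a hh hf)

omit [Group G] [LieGroup I ∞ G] in
lemma HasVelocity.comp {f : G → G} {c : ℝ → G} {s : ℝ} {a : G}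
    {v : TangentSpace I a} (hc : HasVelocity I c s v) (hf : MDifferentiableAt I I f a) :
    HasVelocity I (fun r ↦ f (c r)) s (a := f a) (mfderiv I I f a v) := by
  obtain ⟨rfl, h⟩ := hc
  refine ⟨rfl, ?_⟩
  refine (hf.hasMFDerivAt.comp s h).congr_mfderiv ?_
  refine ContinuousLinearMap.ext_ring ?_
  change (show E →L[ℝ] E from mfderiv I I f (c s)) ((1 : ℝ) • (show E from v)) =
    (1 : ℝ) • (show E →L[ℝ] E from mfderiv I I f (c s)) v
  rw [one_smul, one_smul]

variable [RiemannianBundle (fun x : G ↦ TangentSpace I x)] {K : Subgroup G}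
  [hK : InvariantMetric I K]

lemma inner_mfderiv_translate (g : G) {k : G} (hk : k ∈ K) (a : G) (u v : TangentSpace I a) :
    inner ℝ (mfderiv I I (fun z : G ↦ g * z * k) a u) (mfderiv I I (fun z : G ↦ g * z * k) a v)
      = inner ℝ u v := by
  have h : ∀ w : TangentSpace I a, mfderiv I I (fun z : G ↦ g * z * k) a w =
      mfderiv I I (fun z : G ↦ z * k) (g * a) (mfderiv I I (fun z : G ↦ g * z) a w) :=
    fun w ↦ congrArg (fun L : E →L[ℝ] E ↦ L w) (mfderiv_comp a
      (mdifferentiableAt_mul_right I k (g * a)) (mdifferentiableAt_mul_left I g a))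
  rw [h, h]
  exact (hK.right k hk _ _ _).trans (hK.left g _ _ _)

lemma norm_mfderiv_translate (g : G) {k : G} (hk : k ∈ K) (a : G) (u : TangentSpace I a) :
    ‖mfderiv I I (fun z : G ↦ g * z * k) a u‖ = ‖u‖ := by
  rw [@norm_eq_sqrt_real_inner, @norm_eq_sqrt_real_inner,
    inner_mfderiv_translate I g hk]

lemma enorm_mfderiv_translate (g : G) {k : G} (hk : k ∈ K) (a : G) (u : TangentSpace I a) :
    ‖mfderiv I I (fun z : G ↦ g * z * k) a u‖ₑ = ‖u‖ₑ := by
  rw [← ofReal_norm, ← ofReal_norm, norm_mfderiv_translate I g hk]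

/-- The differential of `z ↦ g * z * k` as a linear isometry of tangent spaces. -/
def translateTangent [FiniteDimensional ℝ E] (g : G) (k : K) (a : G) :
    TangentSpace I a ≃ₗᵢ[ℝ] TangentSpace I (g * a * k) :=
  haveI : FiniteDimensional ℝ (TangentSpace I a) := inferInstanceAs (FiniteDimensional ℝ E)
  haveI : FiniteDimensional ℝ (TangentSpace I (g * a * k)) :=
    inferInstanceAs (FiniteDimensional ℝ E)
  LinearIsometry.toLinearIsometryEquiv
    (⟨(mfderiv I I (fun z : G ↦ g * z * k) a).toLinearMap,
      fun v ↦ norm_mfderiv_translate I g k.2 a v⟩ :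
        TangentSpace I a →ₗᵢ[ℝ] TangentSpace I (g * a * k)) rfl

lemma riemannianEDist_translate_le (g : G) {k : G} (hk : k ∈ K) (a b : G) :
    Manifold.riemannianEDist I (g * a * k) (g * b * k) ≤ Manifold.riemannianEDist I a b := by
  conv_rhs => rw [Manifold.riemannianEDist]
  refine le_iInf₂ fun γ hγ ↦ ?_
  rw [Manifold.riemannianEDist]
  have hf := contMDiff_translate I g k
  refine (iInf₂_le (γ.map hf.continuous) ((hf.of_le (by simp)).comp hγ)).trans_eq ?_
  refine lintegral_congr fun t ↦ ?_
  have h := mfderiv_comp t (mdifferentiableAt_translate I g k (γ t))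
    (hγ.mdifferentiableAt (x := t) one_ne_zero)
  have h1 := congrArg (fun L : TangentSpace (𝓡∂ 1) t →L[ℝ] E ↦ L 1) h
  refine Eq.trans ?_ (enorm_mfderiv_translate I g hk (γ t) _)
  exact congrArg (fun w : TangentSpace I (g * γ t * k) ↦ ‖w‖ₑ) h1

lemma riemannianEDist_translate (g : G) {k : G} (hk : k ∈ K) (a b : G) :
    Manifold.riemannianEDist I (g * a * k) (g * b * k) = Manifold.riemannianEDist I a b := by
  refine le_antisymm (riemannianEDist_translate_le I g hk a b) ?_
  simpa [mul_assoc] using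
    riemannianEDist_translate_le I g⁻¹ (K.inv_mem hk) (g * a * k) (g * b * k)

end Translation

section TranslateCurve

variable {E : Type*} [NormedAddCommGroup E] [NormedSpace ℝ E]
  {H : Type*} [TopologicalSpace H] (I : ModelWithCorners ℝ E H)
  {G : Type*} [TopologicalSpace G] [ChartedSpace H G] [Group G] [LieGroup I ∞ G]

lemma curveDeriv_translate (g k : G) (α : unitInterval → G) (t : unitInterval) :
    (curveDeriv I (fun s ↦ g * α s * k) t : E) =
      mfderiv I I (fun z : G ↦ g * z * k) (α t) (curveDeriv I α t) := by
  have hα : Set.IccExtend zero_le_one α (t : ℝ) = α t := Set.IccExtend_val _ _ _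
  have hf : ∀ z, MDifferentiableAt I I (fun z : G ↦ g * z * k) z :=
    mdifferentiableAt_translate I g k
  by_cases h : MDifferentiableAt 𝓘(ℝ, ℝ) I (Set.IccExtend zero_le_one α) (t : ℝ)
  · have h1 := mfderiv_comp (t : ℝ) (hf _) h
    exact (congrArg (fun L : ℝ →L[ℝ] E ↦ L 1) h1).trans (mfderiv_congr_base I hα _)
  · have h' : ¬ MDifferentiableAt 𝓘(ℝ, ℝ) I
        (Set.IccExtend zero_le_one fun s ↦ g * α s * k) (t : ℝ) := by
      intro h2
      apply h
      have h3 := (mdifferentiableAt_translate I g⁻¹ k⁻¹ _).comp (t : ℝ) h2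
      convert h3 using 1
      ext s
      simp [Set.IccExtend, mul_assoc]
    have e1 := congrArg (fun L : ℝ →L[ℝ] E ↦ L 1) (mfderiv_zero_of_not_mdifferentiableAt h)
    have e2 := congrArg (fun L : ℝ →L[ℝ] E ↦ L 1) (mfderiv_zero_of_not_mdifferentiableAt h')
    refine e2.trans ?_
    refine Eq.trans ?_ (congrArg (mfderiv I I (fun z : G ↦ g * z * k) (α t) :
      E →L[ℝ] E) e1.symm)
    exact (map_zero (mfderiv I I (fun z : G ↦ g * z * k) (α t) : E →L[ℝ] E)).symm

lemma leftDeriv_translate (g k : G) (α : unitInterval → G) (t : unitInterval) :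
    leftDeriv I (fun s ↦ g * α s * k) t = Ad I k⁻¹ (leftDeriv I α t) := by
  set a := α t
  have e1 : (leftDeriv I (fun s ↦ g * α s * k) t : E) =
      mfderiv I I (fun z : G ↦ (g * a * k)⁻¹ * (g * z * k)) a (curveDeriv I α t) := by
    refine Eq.trans ?_ (mfderiv_comp_model I (f := fun z : G ↦ g * z * k) (b := g * a * k)
      (h := fun z : G ↦ (g * a * k)⁻¹ * z) rfl
      (mdifferentiableAt_mul_left I _ _) (mdifferentiableAt_translate I g k a) _).symm
    exact congrArg (mfderiv I I (fun z : G ↦ (g * a * k)⁻¹ * z) (g * a * k) : E →L[ℝ] E)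
      (curveDeriv_translate I g k α t)
  have e2 : (Ad I k⁻¹ (leftDeriv I α t) : E) =
      mfderiv I I (fun z : G ↦ k⁻¹ * (a⁻¹ * z) * k⁻¹⁻¹) a (curveDeriv I α t) :=
    (mfderiv_comp_model I (f := fun z : G ↦ a⁻¹ * z) (b := 1)
      (h := fun z : G ↦ k⁻¹ * z * k⁻¹⁻¹) (inv_mul_cancel a)
      (mdifferentiableAt_translate I _ _ _) (mdifferentiableAt_mul_left I _ a) _).symm
  refine e1.trans (Eq.trans ?_ e2.symm)
  have h : (fun z : G ↦ (g * a * k)⁻¹ * (g * z * k)) =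
      fun z : G ↦ k⁻¹ * (a⁻¹ * z) * k⁻¹⁻¹ := by
    ext z; group
  rw [h]
  rfl

variable [RiemannianBundle (fun x : G ↦ TangentSpace I x)] {K : Subgroup G}
  [hK : InvariantMetric I K]

lemma norm_curveDeriv_translate (g : G) {k : G} (hk : k ∈ K) (α : unitInterval → G)
    (t : unitInterval) : ‖curveDeriv I (fun s ↦ g * α s * k) t‖ = ‖curveDeriv I α t‖ := by
  rw [← norm_mfderiv_translate I g hk (α t)]
  exact congrArg (fun w : TangentSpace I (g * α t * k) ↦ ‖w‖) (curveDeriv_translate I g k α t)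

lemma srv_translate (g : G) {k : G} (hk : k ∈ K) (α : unitInterval → G)
    (t : unitInterval) : srv I (fun s ↦ g * α s * k) t = Ad I k⁻¹ (srv I α t) := by
  unfold srv
  rw [norm_curveDeriv_translate I g hk, leftDeriv_translate, map_smul]

variable {I}

lemma IsHorizontalLift.translate (g : G) (k : K) {α : unitInterval → G}
    {β : unitInterval → G ⧸ K} (h : IsHorizontalLift I K α β) :
    IsHorizontalLift I K (fun s ↦ g * α s * k) (fun s ↦ g • β s) where
  ac f hf := h.ac (fun z ↦ f (g * z * k)) (hf.comp (contMDiff_translate I g k))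
  proj t := by
    rw [← h.proj t]
    exact QuotientGroup.mk_mul_of_mem _ k.2
  horizontal := by
    filter_upwards [h.horizontal] with t ht
    rw [leftDeriv_translate]
    exact Ad_mem_perp I (K.inv_mem k.2) ht

lemma Represents.translate {x : Total I K} {β : ACCurve I K} (h : Represents x β) (g : G)
    (k : K) : Represents (g * x.1 * k, (conjPerp I K k).compLp x.2) (β.leftMul g) := by
  obtain ⟨α, hα, h0, hq⟩ := h
  refine ⟨_, hα.translate g k, by rw [h0], ?_⟩
  filter_upwards [hq, (conjPerp I K k).coeFn_compLp x.2] with t ht ht'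
  rw [srv_translate I g k.2, ← ht]
  exact congrArg Subtype.val ht'

end TranslateCurve

namespace Reparam

instance : CoeFun Reparam (fun _ ↦ unitInterval → unitInterval) := ⟨fun γ ↦ γ.1⟩

/-- The inverse of a reparametrization. -/
def symm (γ : Reparam) : Reparam :=
  ⟨γ.1.symm, fun s t hst ↦ by
    refine lt_of_not_ge fun h ↦ ?_
    have h' := γ.2.monotone h
    simp only [Diffeomorph.apply_symm_apply] at h'
    exact absurd hst (not_lt.2 h')⟩

@[simp] lemma apply_symm_apply (γ : Reparam) (t : unitInterval) : γ (γ.symm t) = t :=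
  γ.1.apply_symm_apply t

@[simp] lemma symm_apply_apply (γ : Reparam) (t : unitInterval) : γ.symm (γ t) = t :=
  γ.1.symm_apply_apply t

lemma continuous (γ : Reparam) : Continuous γ := γ.1.continuous

lemma map_zero (γ : Reparam) : γ 0 = 0 := by
  refine le_antisymm ?_ bot_le
  have h : γ 0 ≤ γ (γ.symm 0) := γ.2.monotone bot_le
  rwa [γ.apply_symm_apply] at h

/-- The extension of a reparametrization to a function on the line. -/
def ext (γ : Reparam) (s : ℝ) : ℝ := γ (Set.projIcc 0 1 zero_le_one s)

lemma ext_coe (γ : Reparam) (t : unitInterval) : γ.ext t = γ t := by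
  simp [ext]

lemma ext_mem (γ : Reparam) (s : ℝ) : γ.ext s ∈ Set.Icc (0 : ℝ) 1 := (γ _).2

lemma contDiffOn_ext (γ : Reparam) : ContDiffOn ℝ 1 γ.ext (Set.Icc 0 1) :=
  contMDiffOn_iff_contDiffOn.1 <|
    (contMDiff_subtypeVal_Icc.comp (γ.1.contMDiff.of_le (by simp))).comp_contMDiffOn
      contMDiffOn_projIcc

lemma injOn_ext (γ : Reparam) : Set.InjOn γ.ext (Set.Icc 0 1) := by
  intro s hs t ht h
  have h1 := γ.2.injective (Subtype.ext h)
  rw [Set.projIcc_of_mem _ hs, Set.projIcc_of_mem _ ht] at h1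
  exact congrArg Subtype.val h1

lemma image_ext (γ : Reparam) : γ.ext '' Set.Icc 0 1 = Set.Icc 0 1 := by
  refine Set.Subset.antisymm (Set.image_subset_iff.2 fun s _ ↦ γ.ext_mem s) fun t ht ↦ ?_
  exact ⟨γ.symm ⟨t, ht⟩, (γ.symm ⟨t, ht⟩).2, by simp [ext_coe]⟩

lemma monotone_ext (γ : Reparam) : Monotone γ.ext := fun _ _ h ↦
  γ.2.monotone (Set.monotone_projIcc _ h)

/-- The derivative of a reparametrization. -/
def speed (γ : Reparam) (t : unitInterval) : ℝ := derivWithin γ.ext (Set.Icc 0 1) t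

lemma hasDerivWithinAt_ext (γ : Reparam) (t : unitInterval) :
    HasDerivWithinAt γ.ext (γ.speed t) (Set.Icc 0 1) t :=
  (γ.contDiffOn_ext.differentiableOn one_ne_zero t t.2).hasDerivWithinAt

lemma continuous_speed (γ : Reparam) : Continuous γ.speed := by
  have h := γ.contDiffOn_ext.continuousOn_derivWithin (uniqueDiffOn_Icc zero_lt_one) le_rfl
  exact continuousOn_iff_continuous_domRestrict.1 h

lemma speed_symm_mul_speed (γ : Reparam) (t : unitInterval) :
    γ.symm.speed (γ t) * γ.speed t = 1 := by
  have h1 := γ.hasDerivWithinAt_ext t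
  have h2 := γ.symm.hasDerivWithinAt_ext (γ t)
  rw [← γ.ext_coe] at h2
  have h3 := h2.comp (t : ℝ) h1 fun s _ ↦ γ.ext_mem s
  have h4 : HasDerivWithinAt (γ.symm.ext ∘ γ.ext) 1 (Set.Icc 0 1) t := by
    refine (hasDerivWithinAt_id (t : ℝ) _).congr_of_mem (fun s hs ↦ ?_) t.2
    have h5 := γ.ext_coe ⟨s, hs⟩
    simp only [Function.comp_apply, id] at h5 ⊢
    rw [h5, ext_coe, symm_apply_apply]
  exact (uniqueDiffOn_Icc zero_lt_one _ t.2).eq_deriv _ h3 h4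

lemma speed_pos (γ : Reparam) (t : unitInterval) : 0 < γ.speed t := by
  have h : 0 ≤ γ.speed t := γ.monotone_ext.monotoneOn _ |>.derivWithin_nonneg
  refine h.lt_of_ne fun h0 ↦ ?_
  have := γ.speed_symm_mul_speed t
  rw [← h0, mul_zero] at this
  exact zero_ne_one this

lemma hasDerivAt_ext (γ : Reparam) {t : unitInterval} (ht : (t : ℝ) ∈ Set.Ioo 0 1) :
    HasDerivAt γ.ext (γ.speed t) t :=
  (γ.hasDerivWithinAt_ext t).hasDerivAt (Icc_mem_nhds ht.1 ht.2)

lemma lintegral_comp (γ : Reparam) (h : unitInterval → ℝ≥0∞) :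
    ∫⁻ t, ENNReal.ofReal (γ.speed t) * h (γ t) = ∫⁻ t, h t := by
  have key : ∀ h : unitInterval → ℝ≥0∞, ∫⁻ t, h t =
      ∫⁻ s in Set.Icc (0 : ℝ) 1, h (Set.projIcc 0 1 zero_le_one s) := by
    intro h
    rw [← lintegral_subtype_comap measurableSet_Icc]
    simp only [Set.projIcc_val]
    rfl
  rw [key h, key]
  conv_rhs => rw [← γ.image_ext]
  rw [lintegral_image_eq_lintegral_abs_deriv_mul measurableSet_Icc
    (fun s hs ↦ γ.hasDerivWithinAt_ext ⟨s, hs⟩ : ∀ s ∈ Set.Icc (0 : ℝ) 1,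
      HasDerivWithinAt γ.ext (derivWithin γ.ext (Set.Icc 0 1) s) (Set.Icc 0 1) s) γ.injOn_ext]
  refine setLIntegral_congr_fun measurableSet_Icc fun s hs ↦ ?_
  have h1 : Set.projIcc 0 1 zero_le_one (γ.ext s) = γ (Set.projIcc 0 1 zero_le_one s) :=
    Set.projIcc_val _ _
  have h2 := γ.speed_pos ⟨s, hs⟩
  simp only [h1]
  rw [Set.projIcc_of_mem _ hs]
  congr 2
  exact (abs_of_pos h2).symm

lemma quasiMeasurePreserving (γ : Reparam) :
    Measure.QuasiMeasurePreserving γ (volume : Measure unitInterval) volume := by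
  refine ⟨γ.continuous.measurable, Measure.AbsolutelyContinuous.mk fun s hs h0 ↦ ?_⟩
  rw [Measure.map_apply γ.continuous.measurable hs]
  have h := γ.lintegral_comp (s.indicator 1)
  rw [lintegral_indicator_one hs, h0, lintegral_eq_zero_iff
    (by
      refine γ.continuous_speed.measurable.ennreal_ofReal.mul ?_
      exact (measurable_one.indicator hs).comp γ.continuous.measurable)] at h
  rw [measure_eq_zero_iff_ae_notMem]
  filter_upwards [h] with t ht hts
  have := γ.speed_pos t
  simp [Set.indicator_of_mem (show γ t ∈ s from hts), this.not_ge] at ht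

lemma ae_comp (γ : Reparam) {p : unitInterval → Prop} (h : ∀ᵐ t, p t) : ∀ᵐ t, p (γ t) :=
  γ.quasiMeasurePreserving.ae h

section Lp

variable {F : Type*} [NormedAddCommGroup F] [NormedSpace ℝ F]

/-- The function `t ↦ √γ'(t) q(γ(t))`. -/
def pull (γ : Reparam) (q : unitInterval → F) (t : unitInterval) : F :=
  √(γ.speed t) • q (γ t)

lemma eLpNorm_pull (γ : Reparam) (q : unitInterval → F) :
    eLpNorm (γ.pull q) 2 volume = eLpNorm q 2 volume := by
  rw [eLpNorm_eq_lintegral_rpow_enorm_toReal two_ne_zero ENNReal.ofNat_ne_top,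
    eLpNorm_eq_lintegral_rpow_enorm_toReal two_ne_zero ENNReal.ofNat_ne_top,
    ← γ.lintegral_comp (fun t ↦ ‖q t‖ₑ ^ _)]
  congr 1
  refine lintegral_congr fun t ↦ ?_
  have h := γ.speed_pos t
  rw [pull, enorm_smul, ENNReal.mul_rpow_of_nonneg _ _ (by simp)]
  congr 1
  rw [Real.enorm_eq_ofReal (Real.sqrt_nonneg _), ENNReal.toReal_ofNat, ENNReal.rpow_ofNat,
    ← ENNReal.ofReal_pow (Real.sqrt_nonneg _), Real.sq_sqrt h.le]

lemma memLp_pull (γ : Reparam) {q : unitInterval → F} (hq : MemLp q 2 volume) :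
    MemLp (γ.pull q) 2 volume := by
  refine ⟨?_, (γ.eLpNorm_pull q).trans_lt hq.2⟩
  exact γ.continuous_speed.sqrt.aestronglyMeasurable.smul
    (hq.1.comp_quasiMeasurePreserving γ.quasiMeasurePreserving)

/-- The linear isometry `q ↦ √γ' q ∘ γ` of `L²`. -/
def pullLp (γ : Reparam) :
    Lp F 2 (volume : Measure unitInterval) →ₗᵢ[ℝ] Lp F 2 (volume : Measure unitInterval) where
  toFun q := (γ.memLp_pull (Lp.memLp q)).toLp
  map_add' p q := by
    refine Lp.ext ?_
    filter_upwards [(γ.memLp_pull (Lp.memLp (p + q))).coeFn_toLp,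
      (γ.memLp_pull (Lp.memLp p)).coeFn_toLp, (γ.memLp_pull (Lp.memLp q)).coeFn_toLp,
      Lp.coeFn_add (γ.memLp_pull (Lp.memLp p)).toLp (γ.memLp_pull (Lp.memLp q)).toLp,
      γ.ae_comp (Lp.coeFn_add p q)] with t h1 h2 h3 h4 h5
    rw [h1, h4, Pi.add_apply, h2, h3, pull, h5, Pi.add_apply, smul_add]
    rfl
  map_smul' c q := by
    refine Lp.ext ?_
    filter_upwards [(γ.memLp_pull (Lp.memLp (c • q))).coeFn_toLp,
      (γ.memLp_pull (Lp.memLp q)).coeFn_toLp,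
      Lp.coeFn_smul c (γ.memLp_pull (Lp.memLp q)).toLp,
      γ.ae_comp (Lp.coeFn_smul c q)] with t h1 h2 h3 h4
    rw [RingHom.id_apply, h1, h3, Pi.smul_apply, h2, pull, h4, Pi.smul_apply, smul_comm]
    rfl
  norm_map' q := by
    change ‖(γ.memLp_pull (Lp.memLp q)).toLp‖ = _
    rw [Lp.norm_toLp, γ.eLpNorm_pull, Lp.norm_def]

lemma coeFn_pullLp (γ : Reparam) (q : Lp F 2 (volume : Measure unitInterval)) :
    γ.pullLp q =ᵐ[volume] γ.pull q :=
  (γ.memLp_pull (Lp.memLp q)).coeFn_toLp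

lemma pullLp_pullLp_symm (γ : Reparam) (q : Lp F 2 (volume : Measure unitInterval)) :
    γ.pullLp (γ.symm.pullLp q) = q := by
  refine Lp.ext ?_
  filter_upwards [γ.coeFn_pullLp (γ.symm.pullLp q), γ.ae_comp (γ.symm.coeFn_pullLp q)]
    with t h1 h2
  rw [h1, pull, h2, pull, smul_smul, symm_apply_apply, mul_comm,
    ← Real.sqrt_mul (γ.symm.speed_pos _).le, speed_symm_mul_speed, Real.sqrt_one, one_smul]

/-- The linear isometry `q ↦ √γ' q ∘ γ` from `L²` onto itself. -/
def pullLpEquiv (γ : Reparam) :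
    Lp F 2 (volume : Measure unitInterval) ≃ₗᵢ[ℝ] Lp F 2 (volume : Measure unitInterval) :=
  LinearIsometryEquiv.ofSurjective γ.pullLp fun q ↦ ⟨_, γ.pullLp_pullLp_symm q⟩

lemma coeFn_pullLpEquiv (γ : Reparam) (q : Lp F 2 (volume : Measure unitInterval)) :
    γ.pullLpEquiv q =ᵐ[volume] γ.pull q :=
  γ.coeFn_pullLp q

lemma pullLpEquiv_compLp (γ : Reparam) (L : F →L[ℝ] F)
    (q : Lp F 2 (volume : Measure unitInterval)) :
    γ.pullLpEquiv (L.compLp q) = L.compLp (γ.pullLpEquiv q) := by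
  refine Lp.ext ?_
  filter_upwards [γ.coeFn_pullLpEquiv (L.compLp q), γ.ae_comp (L.coeFn_compLp q),
    L.coeFn_compLp (γ.pullLpEquiv q), γ.coeFn_pullLpEquiv q] with t h1 h2 h3 h4
  rw [h1, pull, h2, h3, h4, pull, map_smul]

end Lp

end Reparam

section ReparamCurve

variable {E : Type*} [NormedAddCommGroup E] [NormedSpace ℝ E]
  {H : Type*} [TopologicalSpace H] (I : ModelWithCorners ℝ E H)
  {G : Type*} [TopologicalSpace G] [ChartedSpace H G]

omit [TopologicalSpace G] in
lemma Reparam.iccExtend_comp (γ : Reparam) (α : unitInterval → G) :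
    Set.IccExtend zero_le_one (α ∘ γ) = Set.IccExtend zero_le_one α ∘ γ.ext := by
  ext s
  simp [Set.IccExtend, Reparam.ext]

lemma curveDeriv_reparam (γ : Reparam) (α : unitInterval → G) {t : unitInterval}
    (ht : (t : ℝ) ∈ Set.Ioo 0 1) (ht' : (γ t : ℝ) ∈ Set.Ioo 0 1) :
    (curveDeriv I (α ∘ γ) t : E) = γ.speed t • (curveDeriv I α (γ t) : E) := by
  have hd := γ.hasDerivAt_ext ht
  have hd' := γ.symm.hasDerivAt_ext ht'
  by_cases h : MDifferentiableAt 𝓘(ℝ, ℝ) I (Set.IccExtend zero_le_one α) (γ t : ℝ)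
  · rw [← γ.ext_coe] at h
    have h1 := h.hasMFDerivAt.comp (t : ℝ) hd.hasFDerivAt.hasMFDerivAt
    rw [← γ.iccExtend_comp] at h1
    refine (congrArg (fun L : ℝ →L[ℝ] E ↦ L 1) h1.mfderiv).trans ?_
    change (mfderiv 𝓘(ℝ, ℝ) I (Set.IccExtend zero_le_one α) (γ.ext t) : ℝ →L[ℝ] E)
      ((1 : ℝ) • γ.speed t) = _
    have h2 : ∀ (L : ℝ →L[ℝ] E) (r : ℝ), L r = r • L 1 := fun L r ↦ by
      rw [← map_smul, smul_eq_mul, mul_one]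
    rw [one_smul]
    refine (h2 _ _).trans ?_
    rw [γ.ext_coe]
    rfl
  · have h' : ¬ MDifferentiableAt 𝓘(ℝ, ℝ) I (Set.IccExtend zero_le_one (α ∘ γ)) (t : ℝ) := by
      intro h2
      apply h
      have h3 : γ.symm.ext (γ t) = t := by rw [Reparam.ext_coe, γ.symm_apply_apply]
      rw [← h3] at h2
      have h4 := h2.comp (γ t : ℝ) hd'.hasFDerivAt.hasMFDerivAt.mdifferentiableAt
      rw [← γ.symm.iccExtend_comp] at h4
      convert h4 using 2
      ext s
      simp
    have e1 := congrArg (fun L : ℝ →L[ℝ] E ↦ L 1) (mfderiv_zero_of_not_mdifferentiableAt h)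
    have e2 := congrArg (fun L : ℝ →L[ℝ] E ↦ L 1) (mfderiv_zero_of_not_mdifferentiableAt h')
    refine e2.trans (Eq.symm ?_)
    exact (congrArg (fun v : E ↦ γ.speed t • v) e1).trans (smul_zero (A := E) _)

lemma ae_mem_Ioo : ∀ᵐ t : unitInterval, (t : ℝ) ∈ Set.Ioo 0 1 := by
  have h0 : ∀ᵐ t : unitInterval, t ≠ 0 := Measure.ae_ne _ _
  have h1 : ∀ᵐ t : unitInterval, t ≠ 1 := Measure.ae_ne _ _
  filter_upwards [h0, h1] with t h0 h1
  exact ⟨unitInterval.pos_iff_ne_zero.2 h0, unitInterval.lt_one_iff_ne_one.2 h1⟩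

variable [Group G]

lemma ae_leftDeriv_reparam (γ : Reparam) (α : unitInterval → G) :
    ∀ᵐ t, leftDeriv I (α ∘ γ) t = γ.speed t • leftDeriv I α (γ t) := by
  filter_upwards [ae_mem_Ioo, γ.ae_comp ae_mem_Ioo] with t ht ht'
  exact (congrArg (mfderiv I I (fun z : G ↦ (α (γ t))⁻¹ * z) (α (γ t)) : E →L[ℝ] E)
    (curveDeriv_reparam I γ α ht ht')).trans (map_smul _ _ _)

variable [RiemannianBundle (fun x : G ↦ TangentSpace I x)] {K : Subgroup G}

lemma ae_srv_reparam (γ : Reparam) (α : unitInterval → G) :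
    ∀ᵐ t, srv I (α ∘ γ) t = √(γ.speed t) • srv I α (γ t) := by
  filter_upwards [ae_mem_Ioo, γ.ae_comp ae_mem_Ioo, ae_leftDeriv_reparam I γ α] with t ht ht' h
  have hs := γ.speed_pos t
  have hn : ‖curveDeriv I (α ∘ γ) t‖ = γ.speed t * ‖curveDeriv I α (γ t)‖ := by
    refine (congrArg (fun w : TangentSpace I (α (γ t)) ↦ ‖w‖)
      (curveDeriv_reparam I γ α ht ht')).trans ?_
    refine (norm_smul _ _).trans ?_
    rw [Real.norm_of_nonneg hs.le]
  rw [srv, srv, h, hn, smul_smul, smul_smul, Real.sqrt_mul hs.le, mul_inv]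
  congr 1
  have h2 : √(γ.speed t) ≠ 0 := (Real.sqrt_pos.2 hs).ne'
  nth_rw 2 [← Real.mul_self_sqrt hs.le]
  field_simp

variable {I}

lemma IsHorizontalLift.reparam (γ : Reparam) {α : unitInterval → G}
    {β : unitInterval → G ⧸ K} (h : IsHorizontalLift I K α β) :
    IsHorizontalLift I K (α ∘ γ) (β ∘ γ) where
  ac f hf := (h.ac f hf).comp_reparam γ
  proj t := h.proj _
  horizontal := by
    filter_upwards [ae_leftDeriv_reparam I γ α, γ.ae_comp h.horizontal] with t h1 h2
    rw [h1]
    exact Submodule.smul_mem _ _ h2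

lemma Represents.reparam [LieGroup I ∞ G] {x : Total I K} {β : ACCurve I K} (h : Represents x β)
    (γ : Reparam) : Represents (x.1, γ.pullLpEquiv x.2) (β.reparam γ) := by
  obtain ⟨α, hα, h0, hq⟩ := h
  refine ⟨_, hα.reparam γ, by simp [h0, γ.map_zero], ?_⟩
  filter_upwards [γ.ae_comp hq, γ.coeFn_pullLpEquiv x.2, ae_srv_reparam I γ α]
    with t h1 h2 h3
  rw [h3, ← h1]
  exact congrArg Subtype.val h2

end ReparamCurve

section Symmetry

variable {E : Type*} [NormedAddCommGroup E] [NormedSpace ℝ E]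
  {H : Type*} [TopologicalSpace H] (I : ModelWithCorners ℝ E H)
  {G : Type*} [TopologicalSpace G] [ChartedSpace H G] [Group G] [LieGroup I ∞ G]

lemma Ad_mul (y z : G) (v : GroupLieAlgebra I G) : Ad I (y * z) v = Ad I y (Ad I z v) := by
  have h : (mfderiv I I (fun w : G ↦ y * (z * w * z⁻¹) * y⁻¹) 1 v : E) = Ad I y (Ad I z v) :=
    mfderiv_comp_model I (f := fun w : G ↦ z * w * z⁻¹) (b := 1)
      (h := fun w : G ↦ y * w * y⁻¹) (by simp) (mdifferentiableAt_translate I _ _ _)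
      (mdifferentiableAt_translate I _ _ _) v
  refine Eq.trans ?_ h
  have e : (fun w : G ↦ y * (z * w * z⁻¹) * y⁻¹) = fun w ↦ (y * z) * w * (y * z)⁻¹ := by
    ext w; group
  rw [e]
  rfl

lemma Ad_one (v : GroupLieAlgebra I G) : Ad I (1 : G) v = v := by
  have h := Ad_mul I (1 : G) 1 v
  rw [one_mul] at h
  have h2 := Ad_Ad_inv I (1 : G) v
  rw [inv_one] at h2
  exact h.trans h2

variable [RiemannianBundle (fun x : G ↦ TangentSpace I x)] {K : Subgroup G}
  [hK : InvariantMetric I K]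

lemma conjPerp_conjPerp (y z : K) (v : perp I K) :
    conjPerp I K y (conjPerp I K z v) = conjPerp I K (z * y) v := by
  refine Subtype.ext ?_
  change Ad I (y : G)⁻¹ (Ad I (z : G)⁻¹ v) = Ad I ((z : G) * y)⁻¹ v
  rw [← Ad_mul, mul_inv_rev]

lemma conjPerp_one (v : perp I K) : conjPerp I K 1 v = v := by
  refine Subtype.ext ?_
  change Ad I (1 : G)⁻¹ (v : GroupLieAlgebra I G) = v
  rw [inv_one, Ad_one]

lemma norm_conjPerp (y : K) (v : perp I K) : ‖conjPerp I K y v‖ = ‖v‖ := by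
  change ‖Ad I (y : G)⁻¹ (v : GroupLieAlgebra I G)‖ = ‖(v : GroupLieAlgebra I G)‖
  rw [@norm_eq_sqrt_real_inner, @norm_eq_sqrt_real_inner, inner_Ad I (K.inv_mem y.2)]

lemma conjPerp_compLp_compLp (y z : K) (q : L2Perp I K) :
    (conjPerp I K y).compLp ((conjPerp I K z).compLp q) = (conjPerp I K (z * y)).compLp q := by
  refine Lp.ext ?_
  filter_upwards [(conjPerp I K y).coeFn_compLp ((conjPerp I K z).compLp q),
    (conjPerp I K z).coeFn_compLp q, (conjPerp I K (z * y)).coeFn_compLp q] with t h1 h2 h3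
  rw [h1, h2, h3, conjPerp_conjPerp]

lemma conjPerp_one_compLp (q : L2Perp I K) : (conjPerp I K 1).compLp q = q := by
  refine Lp.ext ?_
  filter_upwards [(conjPerp I K 1).coeFn_compLp q] with t h1
  rw [h1, conjPerp_one]

/-- The linear isometry `q ↦ y⁻¹ q y` of `L²([0,1], 𝔨^⊥)`. -/
def conjLp (y : K) : L2Perp I K ≃ₗᵢ[ℝ] L2Perp I K :=
  LinearIsometryEquiv.ofSurjective
    ⟨((conjPerp I K y).compLpL 2 volume).toLinearMap, fun q ↦ by
      have h : ∀ᵐ t, ‖(conjPerp I K y).compLp q t‖ = ‖q t‖ := by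
        filter_upwards [(conjPerp I K y).coeFn_compLp q] with t ht
        rw [ht, norm_conjPerp]
      exact le_antisymm (Lp.norm_le_norm_of_ae_le (h.mono fun _ ht ↦ ht.le))
        (Lp.norm_le_norm_of_ae_le (h.mono fun _ ht ↦ ht.ge))⟩
    fun q ↦ ⟨(conjPerp I K y⁻¹).compLp q, by
      have := conjPerp_compLp_compLp I y y⁻¹ q
      rw [inv_mul_cancel, conjPerp_one_compLp] at this
      exact this⟩

lemma conjLp_conjLp (y z : K) (q : L2Perp I K) :
    conjLp I y (conjLp I z q) = conjLp I (z * y) q := conjPerp_compLp_compLp I y z q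

variable {I}

lemma act_act (x : Total I K) (y z : K) : act (act x y) z = act x (y * z) :=
  Prod.ext (by simp [act, mul_assoc]) (conjPerp_compLp_compLp I z y x.2)

variable (I K) in
/-- A transformation `(a, q) ↦ (g a k, U q)` of `G × L²([0,1], 𝔨^⊥)`, for a linear isometry `U` that
makes it equivariant along `y ↦ k⁻¹ y k`. -/
structure TotalSymmetry where
  left : G
  right : K
  lin : L2Perp I K ≃ₗᵢ[ℝ] L2Perp I K
  lin_conj : ∀ (y : K) (q : L2Perp I K),
    lin (conjLp I y q) = conjLp I (right⁻¹ * y * right) (lin q)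

namespace TotalSymmetry

/-- The underlying map. -/
def map (S : TotalSymmetry I K) (x : Total I K) : Total I K :=
  (S.left * x.1 * S.right, S.lin x.2)

/-- The inverse transformation. -/
def symm (S : TotalSymmetry I K) : TotalSymmetry I K where
  left := S.left⁻¹
  right := S.right⁻¹
  lin := S.lin.symm
  lin_conj y q := by
    apply S.lin.injective
    rw [S.lin_conj, S.lin.apply_symm_apply, S.lin.apply_symm_apply]
    congr 1
    group

/-- The transformation followed by the action of `y`. -/
def thenAct (S : TotalSymmetry I K) (y : K) : TotalSymmetry I K where
  left := S.left
  right := S.right * y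
  lin := S.lin.trans (conjLp I y)
  lin_conj z q := by
    simp only [LinearIsometryEquiv.trans_apply, S.lin_conj, conjLp_conjLp]
    congr 1
    group

variable (I K) in
/-- Left translation by `g`. -/
def ofLeft (g : G) : TotalSymmetry I K := ⟨g, 1, .refl ℝ _, by simp⟩

variable (I K) in
/-- Reparametrization by `γ`. -/
def ofReparam (γ : Reparam) : TotalSymmetry I K := ⟨1, 1, γ.pullLpEquiv, fun y q ↦ by
  rw [inv_one, one_mul, mul_one]
  exact γ.pullLpEquiv_compLp (conjPerp I K y) q⟩

lemma map_thenAct (S : TotalSymmetry I K) (y : K) (x : Total I K) :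
    (S.thenAct y).map x = act (S.map x) y :=
  Prod.ext (mul_assoc _ _ _).symm rfl

lemma map_symm_map (S : TotalSymmetry I K) (x : Total I K) : S.symm.map (S.map x) = x :=
  Prod.ext (by simp [map, symm, mul_assoc]) (by simp [map, symm])

lemma map_act (S : TotalSymmetry I K) (x : Total I K) (y : K) :
    S.map (act x y) = act (S.map x) (S.right⁻¹ * y * S.right) :=
  Prod.ext (by simp [map, act, mul_assoc]) (S.lin_conj y x.2)

lemma act_map (S : TotalSymmetry I K) (x : Total I K) (y : K) :
    act (S.map x) y = S.map (act x (S.right * y * S.right⁻¹)) := by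
  rw [map_act]
  congr 1
  group

lemma orbitDist_map (S : TotalSymmetry I K) (x₁ x₂ : Total I K) :
    orbitDist (S.map x₁) (S.map x₂) = orbitDist x₁ x₂ := by
  unfold orbitDist
  refine Equiv.iInf_congr (MulAut.conj S.right).toEquiv fun y ↦ ?_
  rw [act_map]
  congr 2
  · exact congrArg (· ^ 2) (riemannianEDist_translate I S.left S.right.2 _ _).symm
  · congr 1
    change _ = ‖S.lin _ - S.lin _‖ₑ
    rw [← map_sub]
    exact (S.lin.enorm_map _).symm

variable [FiniteDimensional ℝ E]

/-- The differential of a symmetry. -/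
def tangent (S : TotalSymmetry I K) (x : Total I K) :
    TotalTangent x ≃ₗᵢ[ℝ] TotalTangent (S.map x) :=
  LinearIsometryEquiv.withLpProdCongr 2 (translateTangent I S.left S.right x.1) S.lin

lemma fst_tangent (S : TotalSymmetry I K) (x : Total I K) (u : TotalTangent x) :
    (S.tangent x u).fst = mfderiv I I (fun z : G ↦ S.left * z * S.right) x.1 u.fst := rfl

lemma snd_tangent (S : TotalSymmetry I K) (x : Total I K) (u : TotalTangent x) :
    (S.tangent x u).snd = S.lin u.snd := rfl

lemma hasTotalVelocity_map (S : TotalSymmetry I K) {c : ℝ → Total I K} {s : ℝ} {x : Total I K}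
    {u : TotalTangent x} (h : HasTotalVelocity c s u) :
    HasTotalVelocity (fun r ↦ S.map (c r)) s (S.tangent x u) :=
  ⟨h.1.comp I (mdifferentiableAt_translate I S.left S.right x.1), congrArg S.lin h.2.1,
    S.lin.toContinuousLinearEquiv.hasFDerivAt.comp_hasDerivAt s h.2.2⟩

lemma hasTotalVelocity_of_map (S : TotalSymmetry I K) {c : ℝ → Total I K} {s : ℝ}
    {x : Total I K} {u : TotalTangent (S.map x)}
    (h : HasTotalVelocity (fun r ↦ S.map (c r)) s u) :
    HasTotalVelocity c s ((S.tangent x).symm u) := by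
  obtain ⟨v, rfl⟩ := (S.tangent x).surjective u
  rw [LinearIsometryEquiv.symm_apply_apply]
  have h' := S.symm.hasTotalVelocity_map h
  simp only [S.map_symm_map] at h'
  have hx := S.map_symm_map x
  have e1 : ((S.symm.tangent (S.map x) (S.tangent x v)).fst : E) = v.fst := by
    rw [fst_tangent, fst_tangent]
    have := mfderiv_comp_model I (f := fun z : G ↦ S.left * z * S.right) (a := x.1)
      (b := S.left * x.1 * S.right) (h := fun z : G ↦ S.left⁻¹ * z * ((S.right⁻¹ : K) : G)) rfl
      (mdifferentiableAt_translate I _ _ _) (mdifferentiableAt_translate I _ _ _) v.fst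
    refine this.symm.trans ?_
    have e : (fun z : G ↦ S.left⁻¹ * (S.left * z * S.right) * ((S.right⁻¹ : K) : G)) = id := by
      ext z; simp [mul_assoc]
    rw [e]
    exact congrArg (fun L : E →L[ℝ] E ↦ L v.fst) (mfderiv_id (I := I) (x := x.1))
  have e2 : (S.symm.tangent (S.map x) (S.tangent x v)).snd = v.snd := by
    rw [snd_tangent, snd_tangent]
    exact S.lin.symm_apply_apply _
  refine ⟨⟨h'.1.1.trans (congrArg Prod.fst hx), h'.1.2.congr_mfderiv ?_⟩,
    h'.2.1.trans (congrArg Prod.snd hx), e2 ▸ h'.2.2⟩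
  exact congrArg (fun w : E ↦ ContinuousLinearMap.toSpanSingleton ℝ w) e1

lemma map_vertical (S : TotalSymmetry I K) (x : Total I K) :
    (vertical x).map ((S.tangent x).toLinearEquiv : TotalTangent x →ₗ[ℝ] TotalTangent (S.map x))
      = vertical (S.map x) := by
  unfold vertical
  rw [Submodule.map_span]
  congr 1
  refine Set.Subset.antisymm ?_ ?_
  · rintro _ ⟨u, ⟨y, hy⟩, rfl⟩
    refine ⟨fun s ↦ S.right⁻¹ * y s * S.right, ?_⟩
    simp only [← map_act]
    exact S.hasTotalVelocity_map hy
  · rintro u ⟨y, hy⟩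
    simp only [act_map] at hy
    exact ⟨_, ⟨_, S.hasTotalVelocity_of_map hy⟩, (S.tangent x).apply_symm_apply u⟩

lemma map_horizontal (S : TotalSymmetry I K) (x : Total I K) :
    (horizontal x).map ((S.tangent x).toLinearEquiv : TotalTangent x →ₗ[ℝ] TotalTangent (S.map x))
      = horizontal (S.map x) := by
  unfold horizontal
  rw [← S.map_vertical]
  exact Submodule.map_orthogonal_equiv _ _

/-- The differential of a symmetry on horizontal vectors. -/
def horizontalTangent (S : TotalSymmetry I K) (x : Total I K) :
    horizontal x ≃ₗᵢ[ℝ] horizontal (S.map x) :=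
  (LinearIsometryEquiv.submoduleMap (horizontal x) (S.tangent x)).trans
    (LinearIsometryEquiv.ofEq _ _ (S.map_horizontal x))

lemma coe_horizontalTangent (S : TotalSymmetry I K) (x : Total I K) (v : horizontal x) :
    (S.horizontalTangent x v : TotalTangent (S.map x)) = S.tangent x v := rfl

end TotalSymmetry

lemma horPart_eq_iff [FiniteDimensional ℝ E] {x : Total I K} {u : TotalTangent x}
    {v : horizontal x} : horPart u = v ↔ u - v ∈ (horizontal x)ᗮ := by
  have : (horizontal x).HasOrthogonalProjection :=
    have : CompleteSpace (horizontal x) := Submodule.instOrthogonalCompleteSpace (vertical x)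
    Submodule.HasOrthogonalProjection.ofCompleteSpace (𝕜 := ℝ) (horizontal x)
  constructor
  · rintro rfl
    exact Submodule.sub_starProjection_mem_orthogonal (K := horizontal x) u
  · intro h
    exact Subtype.ext (Submodule.eq_starProjection_of_mem_orthogonal (K := horizontal x) v.2 h)

lemma TotalSymmetry.horPart_tangent [FiniteDimensional ℝ E] (S : TotalSymmetry I K)
    {x : Total I K} (u : TotalTangent x) :
    horPart (S.tangent x u) = S.horizontalTangent x (horPart u) := by
  rw [horPart_eq_iff, S.coe_horizontalTangent, ← map_sub, ← S.map_horizontal,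
    ← Submodule.map_orthogonal_equiv]
  exact Submodule.mem_map_of_mem (horPart_eq_iff.1 rfl)

end Symmetry

section AbsolutelyContinuous

variable {X Y : Type*} [PseudoMetricSpace X] [PseudoMetricSpace Y]

/-- The composition of an absolutely continuous function with a Lipschitz map is absolutely
continuous. -/
lemma _root_.LipschitzOnWith.comp_absolutelyContinuousOnInterval {L : NNReal} {f : X → Y}
    {s : Set X} {u : ℝ → X} {a b : ℝ} (hf : LipschitzOnWith L f s)
    (hu : AbsolutelyContinuousOnInterval u a b) (hus : ∀ t ∈ Set.uIcc a b, u t ∈ s) :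
    AbsolutelyContinuousOnInterval (f ∘ u) a b := by
  rw [absolutelyContinuousOnInterval_iff] at hu ⊢
  intro ε hε
  obtain ⟨δ, hδ, h⟩ := hu (ε / (L + 1)) (by positivity)
  refine ⟨δ, hδ, fun J hJ hJδ ↦ ?_⟩
  have hL : (0 : ℝ) < L + 1 := by positivity
  calc ∑ i ∈ Finset.range J.1, dist (f (u (J.2 i).1)) (f (u (J.2 i).2))
      ≤ ∑ i ∈ Finset.range J.1, (L + 1) * dist (u (J.2 i).1) (u (J.2 i).2) := by
        refine Finset.sum_le_sum fun i hi ↦ ?_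
        have hm := hJ.1 i hi
        refine (hf.dist_le_mul _ (hus _ hm.1) _ (hus _ hm.2)).trans ?_
        gcongr
        linarith
    _ = (L + 1) * ∑ i ∈ Finset.range J.1, dist (u (J.2 i).1) (u (J.2 i).2) := by
        rw [Finset.mul_sum]
    _ < ε := by
        have := h J hJ hJδ
        rw [lt_div_iff₀ hL] at this
        linarith

lemma _root_.AbsolutelyContinuousOnInterval.congr {u v : ℝ → X} {a b : ℝ}
    (hu : AbsolutelyContinuousOnInterval u a b) (h : Set.EqOn u v (Set.uIcc a b)) :
    AbsolutelyContinuousOnInterval v a b := by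
  rw [absolutelyContinuousOnInterval_iff] at hu ⊢
  intro ε hε
  obtain ⟨δ, hδ, hd⟩ := hu ε hε
  refine ⟨δ, hδ, fun J hJ hJδ ↦ (Finset.sum_congr rfl fun i hi ↦ ?_).trans_lt (hd J hJ hJδ)⟩
  have hm := hJ.1 i hi
  rw [h hm.1, h hm.2]

lemma _root_.AbsolutelyContinuousOnInterval.prodMk {F F' : Type*} [NormedAddCommGroup F]
    [NormedSpace ℝ F] [NormedAddCommGroup F'] [NormedSpace ℝ F'] {u : ℝ → F} {v : ℝ → F'}
    {a b : ℝ} (hu : AbsolutelyContinuousOnInterval u a b)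
    (hv : AbsolutelyContinuousOnInterval v a b) :
    AbsolutelyContinuousOnInterval (fun t ↦ (u t, v t)) a b := by
  have h₁ := ((ContinuousLinearMap.inl ℝ F F').lipschitz.lipschitzOnWith
    (s := Set.univ)).comp_absolutelyContinuousOnInterval hu fun _ _ ↦ Set.mem_univ _
  have h₂ := ((ContinuousLinearMap.inr ℝ F F').lipschitz.lipschitzOnWith
    (s := Set.univ)).comp_absolutelyContinuousOnInterval hv fun _ _ ↦ Set.mem_univ _
  refine (h₁.add h₂).congr fun t _ ↦ ?_
  simp

/-- A function into a finite-dimensional space is absolutely continuous if its compositions with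
the linear forms are. -/
lemma absolutelyContinuousOnInterval_of_dual {F : Type*} [NormedAddCommGroup F]
    [NormedSpace ℝ F] [FiniteDimensional ℝ F] {u : ℝ → F} {a b : ℝ}
    (h : ∀ ℓ : F →L[ℝ] ℝ, AbsolutelyContinuousOnInterval (fun t ↦ ℓ (u t)) a b) :
    AbsolutelyContinuousOnInterval u a b := by
  let B := Module.finBasis ℝ F
  have key : ∀ s : Finset (Fin (Module.finrank ℝ F)),
      AbsolutelyContinuousOnInterval (fun t ↦ ∑ i ∈ s, B.repr (u t) i • B i) a b := by
    intro s
    induction s using Finset.induction_on with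
    | empty =>
      simpa using (LipschitzWith.const (0 : F)).lipschitzOnWith.absolutelyContinuousOnInterval
    | insert i s hi ih =>
      simp only [Finset.sum_insert hi]
      refine AbsolutelyContinuousOnInterval.add ?_ ih
      have h₁ := h (LinearMap.toContinuousLinearMap (B.coord i))
      exact ((ContinuousLinearMap.toSpanSingleton ℝ (B i)).lipschitz.lipschitzOnWith
        (s := Set.univ)).comp_absolutelyContinuousOnInterval h₁ fun _ _ ↦ Set.mem_univ _
  refine (key Finset.univ).congr fun t _ ↦ ?_
  exact B.sum_repr (u t)

end AbsolutelyContinuous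

section LocallyAC

variable {E : Type*} [NormedAddCommGroup E] [NormedSpace ℝ E]
  {H : Type*} [TopologicalSpace H] (I : ModelWithCorners ℝ E H)
  {M : Type*} [TopologicalSpace M] [ChartedSpace H M]
  {E' : Type*} [NormedAddCommGroup E'] [NormedSpace ℝ E']
  {H' : Type*} [TopologicalSpace H'] (I' : ModelWithCorners ℝ E' H')
  {M' : Type*} [TopologicalSpace M'] [ChartedSpace H' M']

/-- The curve `c`, defined on the line, is absolutely continuous in a chart at `c t` on every small
neighbourhood of `t` in `[0,1]`. -/
def LocallyAC (c : ℝ → M) (t : ℝ) : Prop :=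
  ContinuousAt c t ∧ ∀ᶠ δ in 𝓝[>] (0 : ℝ),
    AbsolutelyContinuousOnInterval (fun s ↦ extChartAt I (c t) (c s))
      (max 0 (t - δ)) (min 1 (t + δ))

lemma uIcc_max_min_subset {t : ℝ} (ht : t ∈ Set.Icc (0 : ℝ) 1) {δ : ℝ} (hδ : 0 < δ) :
    Set.uIcc (max 0 (t - δ)) (min 1 (t + δ)) = Set.Icc 0 1 ∩ Set.Icc (t - δ) (t + δ) := by
  rw [Set.uIcc_of_le, Set.Icc_inter_Icc]
  have := ht.1
  have := ht.2
  simp only [max_le_iff, le_min_iff]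
  refine ⟨⟨?_, ?_⟩, ?_, ?_⟩ <;> linarith

lemma eventually_forall_uIcc {p : ℝ → Prop} {t : ℝ} (ht : t ∈ Set.Icc (0 : ℝ) 1)
    (h : ∀ᶠ s in 𝓝 t, p s) :
    ∀ᶠ δ in 𝓝[>] (0 : ℝ), ∀ s ∈ Set.uIcc (max 0 (t - δ)) (min 1 (t + δ)), p s := by
  obtain ⟨r, hr, h⟩ := Metric.eventually_nhds_iff.1 h
  filter_upwards [Ioo_mem_nhdsGT hr] with δ hδ s hs
  rw [uIcc_max_min_subset ht hδ.1] at hs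
  refine h ?_
  rw [Real.dist_eq, abs_lt]
  constructor <;> linarith [hs.2.1, hs.2.2, hδ.2]

variable {I I'}

lemma LocallyAC.prodMk {c : ℝ → M} {c' : ℝ → M'} {t : ℝ} (h : LocallyAC I c t)
    (h' : LocallyAC I' c' t) : LocallyAC (I.prod I') (fun s ↦ (c s, c' s)) t := by
  refine ⟨h.1.prodMk h'.1, ?_⟩
  filter_upwards [h.2, h'.2] with δ h₁ h₂
  simpa [extChartAt_prod] using h₁.prodMk h₂

lemma LocallyAC.comp [I.Boundaryless] {c : ℝ → M} {t : ℝ} (h : LocallyAC I c t)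
    (ht : t ∈ Set.Icc (0 : ℝ) 1) {F : M → M'} (hF : ContMDiffAt I I' 1 F (c t)) :
    LocallyAC I' (fun s ↦ F (c s)) t := by
  refine ⟨ContinuousAt.comp (f := c) (g := F) hF.continuousAt h.1, ?_⟩
  have hd := (contMDiffAt_iff.1 hF).2
  rw [I.range_eq_univ, contDiffWithinAt_univ] at hd
  obtain ⟨L, V, hV, hL⟩ := hd.exists_lipschitzOnWith
  have hcont : ContinuousAt (fun s ↦ extChartAt I (c t) (c s)) t :=
    ContinuousAt.comp (f := c) (continuousAt_extChartAt (c t)) h.1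
  have hsrc : ∀ᶠ s in 𝓝 t, c s ∈ (extChartAt I (c t)).source :=
    h.1 (extChartAt_source_mem_nhds (c t))
  filter_upwards [h.2, eventually_forall_uIcc ht (hcont hV), eventually_forall_uIcc ht hsrc]
    with δ h₁ h₂ h₃
  refine (hL.comp_absolutelyContinuousOnInterval h₁ h₂).congr fun s hs ↦ ?_
  simp only [Function.comp_apply, (extChartAt I (c t)).left_inv (h₃ s hs)]

lemma LocallyAC.ae_mdifferentiableAt [FiniteDimensional ℝ E] [I.Boundaryless] [IsManifold I 1 M]
    {c : ℝ → M} {t : ℝ} (hc : Continuous c) (h : LocallyAC I c t) (ht : t ∈ Set.Icc (0 : ℝ) 1) :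
    ∀ᶠ δ in 𝓝[>] (0 : ℝ), ∀ᵐ s, s ∈ Set.uIcc (max 0 (t - δ)) (min 1 (t + δ)) →
      MDifferentiableAt 𝓘(ℝ, ℝ) I c s := by
  have hsrc : ∀ᶠ s in 𝓝 t, c s ∈ (extChartAt I (c t)).source :=
    h.1 (extChartAt_source_mem_nhds (c t))
  filter_upwards [h.2, eventually_forall_uIcc ht hsrc] with δ h₁ h₂
  filter_upwards [h₁.boundedVariationOn.ae_differentiableAt_of_mem_uIcc] with s hs hm
  have hd := (hs hm).mdifferentiableAt
  have hms := h₂ s hm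
  have hsymm : MDifferentiableAt 𝓘(ℝ, E) I (extChartAt I (c t)).symm
      (extChartAt I (c t) (c s)) := by
    have := mdifferentiableWithinAt_extChartAt_symm (I := I) ((extChartAt I (c t)).map_source hms)
    rwa [I.range_eq_univ, mdifferentiableWithinAt_univ] at this
  have hcomp := MDifferentiableAt.comp (I := 𝓘(ℝ, ℝ)) (I' := 𝓘(ℝ, E)) (I'' := I) s
    (f := fun s ↦ extChartAt I (c t) (c s)) (g := (extChartAt I (c t)).symm) hsymm hd
  refine hcomp.congr_of_eventuallyEq ?_
  filter_upwards [hc.continuousAt ((isOpen_extChartAt_source (c t)).mem_nhds hms)] with r hr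
  exact ((extChartAt I (c t)).left_inv hr).symm

lemma LocallyAC.eventually_eq_of_mfderiv_eq_zero [IsManifold I 1 M]
    [FiniteDimensional ℝ E] {c : ℝ → M} {t : ℝ}
    (h : LocallyAC I c t) (ht : t ∈ Set.Icc (0 : ℝ) 1)
    (h0 : ∀ᶠ δ in 𝓝[>] (0 : ℝ), ∀ᵐ s, s ∈ Set.uIcc (max 0 (t - δ)) (min 1 (t + δ)) →
      HasMFDerivAt 𝓘(ℝ, ℝ) I c s 0) :
    ∀ᶠ δ in 𝓝[>] (0 : ℝ), ∀ s ∈ Set.uIcc (max 0 (t - δ)) (min 1 (t + δ)), c s = c t := by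
  have hsrc : ∀ᶠ s in 𝓝 t, c s ∈ (extChartAt I (c t)).source :=
    h.1 (extChartAt_source_mem_nhds (c t))
  filter_upwards [h.2, eventually_forall_uIcc ht hsrc, h0, self_mem_nhdsWithin]
    with δ h₁ h₂ h₃ hδ s hs
  have key : ∀ᵐ s, s ∈ Set.uIcc (max 0 (t - δ)) (min 1 (t + δ)) →
      HasDerivAt (fun s ↦ extChartAt I (c t) (c s)) 0 s := by
    filter_upwards [h₃] with s hs hm
    have hms := h₂ s hm
    rw [extChartAt_source] at hms
    have hd := ((hasMFDerivAt_extChartAt (I := I) hms).comp s (hs hm)).hasFDerivAt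
    rw [hasDerivAt_iff_hasFDerivAt]
    refine hd.congr_fderiv ?_
    refine ContinuousLinearMap.ext_ring ?_
    refine Eq.trans ?_ (smul_zero (A := E) (1 : ℝ)).symm
    exact map_zero (mfderiv I I (chartAt H (c t)) (c s) : E →L[ℝ] E)
  obtain ⟨C, hC⟩ := h₁.const_of_ae_hasDerivAt_zero key
  have htm : t ∈ Set.uIcc (max 0 (t - δ)) (min 1 (t + δ)) := by
    rw [uIcc_max_min_subset ht hδ]
    have : (0 : ℝ) < δ := hδ
    exact ⟨ht, by linarith, by linarith⟩
  exact (extChartAt I (c t)).injOn (h₂ s hs) (h₂ t htm) ((hC s hs).trans (hC t htm).symm)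

end LocallyAC

section GroupCurve

variable {E : Type*} [NormedAddCommGroup E] [NormedSpace ℝ E] [FiniteDimensional ℝ E]
  {H : Type*} [TopologicalSpace H] {I : ModelWithCorners ℝ E H}
  {M : Type*} [TopologicalSpace M] [ChartedSpace H M] [T2Space M] [IsManifold I ∞ M]

lemma IsACGroup.continuous {α : unitInterval → M} (hα : IsACGroup I α) : Continuous α := by
  rw [continuous_iff_continuousAt]
  intro t
  refine (SmoothBumpFunction.nhds_basis_support (I := I) (Filter.univ_mem)).tendsto_right_iff.2
    fun f _ ↦ ?_
  have h := (hα f f.contMDiff).continuousOn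
  rw [Set.uIcc_of_le zero_le_one, continuousOn_iff_continuous_domRestrict] at h
  have h' : Continuous (f ∘ α) := by
    convert h using 1
    ext s
    simp
  refine h'.continuousAt.eventually_ne ?_
  exact (f.eq_one.trans_ne one_ne_zero)

lemma IsACGroup.locallyAC {α : unitInterval → M} (hα : IsACGroup I α) {t : ℝ} :
    t ∈ Set.Icc (0 : ℝ) 1 → LocallyAC I (Set.IccExtend zero_le_one α) t := by
  intro ht
  have hc := (hα.continuous.Icc_extend' (h := zero_le_one)).continuousAt (x := t)
  refine ⟨hc, ?_⟩
  set a := Set.IccExtend zero_le_one α t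
  obtain ⟨f⟩ : Nonempty (SmoothBumpFunction I a) := inferInstance
  have h1 : ∀ᶠ s in 𝓝 t, f (Set.IccExtend zero_le_one α s) = 1 := hc f.eventuallyEq_one
  filter_upwards [eventually_forall_uIcc ht h1, self_mem_nhdsWithin] with δ h₁ hδ
  refine absolutelyContinuousOnInterval_of_dual fun ℓ ↦ ?_
  have hs : ContMDiff I 𝓘(ℝ, ℝ) ∞ fun x ↦ f x • ℓ (extChartAt I a x) :=
    f.contMDiff_smul (ℓ.contMDiff.comp_contMDiffOn contMDiffOn_extChartAt)
  refine ((hα _ hs).mono ?_).congr fun s hs ↦ ?_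
  · rw [uIcc_max_min_subset ht hδ, Set.uIcc_of_le zero_le_one]
    exact Set.inter_subset_left
  · have := h₁ s hs
    simp only [Set.IccExtend, Function.comp_apply] at this ⊢
    rw [this, one_smul]

end GroupCurve

section Uniqueness

variable {E : Type*} [NormedAddCommGroup E] [NormedSpace ℝ E]
  {H : Type*} [TopologicalSpace H] {I : ModelWithCorners ℝ E H}
  {G : Type*} [TopologicalSpace G] [ChartedSpace H G] [Group G]

omit [Group G] in
lemma hasVelocity_curveDeriv {α : unitInterval → G} {t : unitInterval}
    (h : MDifferentiableAt 𝓘(ℝ, ℝ) I (Set.IccExtend zero_le_one α) (t : ℝ)) :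
    HasVelocity I (fun s ↦ Set.IccExtend zero_le_one α (t + s)) 0 (curveDeriv I α t) := by
  have hd : HasDerivAt (fun s : ℝ ↦ (t : ℝ) + s) 1 0 := (hasDerivAt_id 0).const_add _
  have ht : (t : ℝ) = t + 0 := (add_zero _).symm
  have h' := h.hasMFDerivAt
  rw [ht] at h'
  refine ⟨by simp, (h'.comp (0 : ℝ) hd.hasFDerivAt.hasMFDerivAt).congr_mfderiv ?_⟩
  refine ContinuousLinearMap.ext_ring ?_
  change (mfderiv 𝓘(ℝ, ℝ) I (Set.IccExtend zero_le_one α) (t + 0 : ℝ) : ℝ →L[ℝ] E)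
    ((1 : ℝ) • (1 : ℝ)) = (1 : ℝ) • (curveDeriv I α t : E)
  rw [one_smul, one_smul, add_zero]
  rfl

variable [LieGroup I ∞ G]

/-- The left translated derivative of a curve in `K` lies in the Lie algebra of `K`. -/
lemma leftDeriv_mem_lieAlg {K : Subgroup G} {κ : unitInterval → G} (hκ : ∀ s, κ s ∈ K)
    {t : unitInterval}
    (h : MDifferentiableAt 𝓘(ℝ, ℝ) I (Set.IccExtend zero_le_one κ) (t : ℝ)) :
    leftDeriv I κ t ∈ lieAlg I K := by
  refine Submodule.subset_span
    ⟨fun s ↦ (κ t)⁻¹ * Set.IccExtend zero_le_one κ (t + s), fun s ↦ ?_, ?_⟩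
  · exact K.mul_mem (K.inv_mem (hκ t)) (hκ _)
  · have hv := (hasVelocity_curveDeriv h).comp I (mdifferentiableAt_mul_left I (κ t)⁻¹ (κ t))
    exact ⟨hv.1.trans (inv_mul_cancel _), hv.2⟩

/-- The product rule for the left translated derivative. -/
lemma leftDeriv_mul {α κ : unitInterval → G} {t : unitInterval}
    (hα : MDifferentiableAt 𝓘(ℝ, ℝ) I (Set.IccExtend zero_le_one α) (t : ℝ))
    (hκ : MDifferentiableAt 𝓘(ℝ, ℝ) I (Set.IccExtend zero_le_one κ) (t : ℝ)) :
    leftDeriv I (fun s ↦ α s * κ s) t = Ad I (κ t)⁻¹ (leftDeriv I α t) + leftDeriv I κ t := by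
  have hα0 : Set.IccExtend zero_le_one α (t : ℝ) = α t := Set.IccExtend_val _ _ _
  have hκ0 : Set.IccExtend zero_le_one κ (t : ℝ) = κ t := Set.IccExtend_val _ _ _
  set a := α t
  set k := κ t
  have hmul : MDifferentiableAt (I.prod I) I (fun p : G × G ↦ p.1 * p.2)
      (Set.IccExtend zero_le_one α (t : ℝ), Set.IccExtend zero_le_one κ (t : ℝ)) :=
    (contMDiff_mul I ∞).mdifferentiableAt (by simp)
  have e1 : (curveDeriv I (fun s ↦ α s * κ s) t : E) =
      (mfderiv I I (fun z : G ↦ z * k) a (curveDeriv I α t) : E) +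
        (mfderiv I I (fun z : G ↦ a * z) k (curveDeriv I κ t) : E) := by
    have h1 := (hmul.hasMFDerivAt.comp (t : ℝ) (hα.hasMFDerivAt.prodMk hκ.hasMFDerivAt)).mfderiv
    have h2 := congrArg (fun L : ℝ →L[ℝ] E ↦ L 1) h1
    refine h2.trans ((mfderiv_prod_eq_add_apply hmul).trans ?_)
    rw [← hα0, ← hκ0]
    rfl
  have e2 : (leftDeriv I (fun s ↦ α s * κ s) t : E) =
      (mfderiv I I (fun z : G ↦ (a * k)⁻¹ * z) (a * k)
        (mfderiv I I (fun z : G ↦ z * k) a (curveDeriv I α t)) : E) +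
      (mfderiv I I (fun z : G ↦ (a * k)⁻¹ * z) (a * k)
        (mfderiv I I (fun z : G ↦ a * z) k (curveDeriv I κ t)) : E) :=
    (congrArg (mfderiv I I (fun z : G ↦ (a * k)⁻¹ * z) (a * k) : E →L[ℝ] E) e1).trans
      (map_add (mfderiv I I (fun z : G ↦ (a * k)⁻¹ * z) (a * k) : E →L[ℝ] E) _ _)
  have e3 := mfderiv_comp_model I (f := fun z : G ↦ z * k) (a := a) (b := a * k)
    (h := fun z : G ↦ (a * k)⁻¹ * z) rfl (mdifferentiableAt_mul_left I _ _)
    (mdifferentiableAt_mul_right I _ _) (curveDeriv I α t)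
  have e4 := mfderiv_comp_model I (f := fun z : G ↦ a * z) (a := k) (b := a * k)
    (h := fun z : G ↦ (a * k)⁻¹ * z) rfl (mdifferentiableAt_mul_left I _ _)
    (mdifferentiableAt_mul_left I _ _) (curveDeriv I κ t)
  have e5 : (mfderiv I I (fun z : G ↦ k⁻¹ * (a⁻¹ * z) * k⁻¹⁻¹) a (curveDeriv I α t) : E) =
      Ad I k⁻¹ (leftDeriv I α t) :=
    mfderiv_comp_model I (f := fun z : G ↦ a⁻¹ * z) (b := 1)
      (h := fun z : G ↦ k⁻¹ * z * k⁻¹⁻¹) (inv_mul_cancel a)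
      (mdifferentiableAt_translate I _ _ _) (mdifferentiableAt_mul_left I _ a) _
  have f1 : (fun z : G ↦ (a * k)⁻¹ * (z * k)) = fun z : G ↦ k⁻¹ * (a⁻¹ * z) * k⁻¹⁻¹ := by
    ext z; group
  have f2 : (fun z : G ↦ (a * k)⁻¹ * (a * z)) = fun z : G ↦ k⁻¹ * z := by
    ext z; group
  rw [f1] at e3
  rw [f2] at e4
  exact e2.trans (congrArg₂ (fun v w : E ↦ v + w) (e3.symm.trans e5) e4.symm)

variable [RiemannianBundle (fun x : G ↦ TangentSpace I x)] {K : Subgroup G}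
  [hK : InvariantMetric I K]

lemma hasMFDerivAt_zero_of_horizontal {α κ : unitInterval → G} (hκ : ∀ s, κ s ∈ K)
    {t : unitInterval} (hα : MDifferentiableAt 𝓘(ℝ, ℝ) I (Set.IccExtend zero_le_one α) (t : ℝ))
    (hd : MDifferentiableAt 𝓘(ℝ, ℝ) I (Set.IccExtend zero_le_one κ) (t : ℝ))
    (h₁ : leftDeriv I α t ∈ perp I K) (h₂ : leftDeriv I (fun s ↦ α s * κ s) t ∈ perp I K) :
    HasMFDerivAt 𝓘(ℝ, ℝ) I (Set.IccExtend zero_le_one κ) (t : ℝ) 0 := by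
  have hperp : leftDeriv I κ t ∈ perp I K := by
    rw [leftDeriv_mul hα hd] at h₂
    exact (Submodule.add_mem_iff_right _ (Ad_mem_perp I (K.inv_mem (hκ t)) h₁)).1 h₂
  have h0 : leftDeriv I κ t = 0 := by
    have := Submodule.inner_right_of_mem_orthogonal (leftDeriv_mem_lieAlg hκ hd) hperp
    exact inner_self_eq_zero.1 this
  have h0' : curveDeriv I κ t = 0 := by
    have hn : inner ℝ (curveDeriv I κ t) (curveDeriv I κ t) = 0 := by
      rw [← hK.left (κ t)⁻¹]
      refine (inner_congr_base I (inv_mul_cancel (κ t)) _ _).trans ?_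
      change inner ℝ (leftDeriv I κ t) (leftDeriv I κ t) = 0
      rw [h0, inner_zero_left]
    exact inner_self_eq_zero.1 hn
  refine hd.hasMFDerivAt.congr_mfderiv ?_
  exact ContinuousLinearMap.ext_ring h0'

variable [FiniteDimensional ℝ E] [I.Boundaryless]

lemma ae_unitInterval_iff {p : unitInterval → Prop} :
    (∀ᵐ t, p t) ↔ ∀ᵐ s : ℝ, ∀ hs : s ∈ Set.Icc (0 : ℝ) 1, p ⟨s, hs⟩ := by
  have h := unitInterval.measurePreserving_coe.map_eq
  have h2 := unitInterval.measurableEmbedding_coe.ae_map_iff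
    (p := fun s ↦ ∀ hs : s ∈ Set.Icc (0 : ℝ) 1, p ⟨s, hs⟩) (μ := volume)
  rw [h, ae_restrict_iff' measurableSet_Icc] at h2
  refine Iff.trans ?_ (h2.symm.trans ?_)
  · exact Filter.eventually_congr (Filter.Eventually.of_forall fun t ↦
      ⟨fun h _ ↦ h, fun h ↦ h t.2⟩)
  · exact Filter.eventually_congr (Filter.Eventually.of_forall fun s ↦
      ⟨fun h hs ↦ h hs hs, fun h _ ↦ h⟩)

/-- Two horizontal lifts of the same curve differ by an element of `K`. -/
lemma IsHorizontalLift.exists_eq_mul {α α' : unitInterval → G} {β : unitInterval → G ⧸ K}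
    (h : IsHorizontalLift I K α β) (h' : IsHorizontalLift I K α' β) :
    ∃ y : K, ∀ t, α' t = α t * y := by
  have : IsTopologicalGroup G := topologicalGroup_of_lieGroup I ∞
  have : T1Space G := I.t1Space G
  have : T2Space G := inferInstance
  have : IsManifold I ∞ G := inferInstance
  have : IsManifold I 1 G := IsManifold.of_le (n := ∞) (by simp)
  set κ : unitInterval → G := fun t ↦ (α t)⁻¹ * α' t
  have hκ : ∀ s, κ s ∈ K := fun s ↦ QuotientGroup.eq.1 ((h.proj s).trans (h'.proj s).symm)
  have hmul : (fun s ↦ α s * κ s) = α' := by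
    funext s
    simp [κ]
  have hc := h.ac.continuous
  have hc' := h'.ac.continuous
  have hF : ContMDiff (I.prod I) I ∞ fun p : G × G ↦ p.1⁻¹ * p.2 :=
    contMDiff_fst.inv.mul contMDiff_snd
  have hconst : ∀ t : unitInterval, ∀ᶠ s in 𝓝 t, κ s = κ t := by
    intro t
    have hl := h.ac.locallyAC t.2
    have hl' := h'.ac.locallyAC t.2
    have hκl : LocallyAC I (Set.IccExtend zero_le_one κ) t :=
      (hl.prodMk hl').comp t.2 (hF.contMDiffAt.of_le (by simp))
    have hz : ∀ᶠ δ in 𝓝[>] (0 : ℝ),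
        ∀ᵐ s, s ∈ Set.uIcc (max 0 ((t : ℝ) - δ)) (min 1 ((t : ℝ) + δ)) →
        HasMFDerivAt 𝓘(ℝ, ℝ) I (Set.IccExtend zero_le_one κ) s 0 := by
      filter_upwards [hl.ae_mdifferentiableAt hc.Icc_extend' t.2,
        hl'.ae_mdifferentiableAt hc'.Icc_extend' t.2, self_mem_nhdsWithin] with δ h₁ h₂ hδ
      filter_upwards [h₁, h₂, ae_unitInterval_iff.1 h.horizontal,
        ae_unitInterval_iff.1 h'.horizontal] with s g₁ g₂ g₃ g₄ hs
      have hs' := hs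
      rw [uIcc_max_min_subset t.2 hδ] at hs'
      refine hasMFDerivAt_zero_of_horizontal (t := ⟨s, hs'.1⟩) hκ (g₁ hs) ?_ (g₃ hs'.1) ?_
      · exact (hF.mdifferentiableAt (by simp)).comp s ((g₁ hs).prodMk (g₂ hs))
      · rw [hmul]
        exact g₄ hs'.1
    obtain ⟨δ, hδ, hδ0⟩ :=
      ((hκl.eventually_eq_of_mfderiv_eq_zero t.2 hz).and self_mem_nhdsWithin).exists
    have hball : ∀ᶠ s in 𝓝 t, dist s t < δ := Metric.ball_mem_nhds t hδ0
    filter_upwards [hball] with s hs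
    have hs' := hδ s (by
      rw [uIcc_max_min_subset t.2 hδ0]
      rw [Subtype.dist_eq, Real.dist_eq, abs_lt] at hs
      exact ⟨s.2, by linarith [hs.1], by linarith [hs.2]⟩)
    simpa using hs'
  have hlc : IsLocallyConstant κ := (IsLocallyConstant.iff_eventually_eq κ).2 hconst
  refine ⟨⟨κ 0, hκ 0⟩, fun t ↦ ?_⟩
  change α' t = α t * κ 0
  rw [hlc.apply_eq_of_preconnectedSpace 0 t]
  simp [κ]

/-- The points that represent a given curve lie in one orbit. -/
lemma Represents.exists_eq_act {x x' : Total I K} {β : ACCurve I K} (h : Represents x β)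
    (h' : Represents x' β) : ∃ y : K, x' = act x y := by
  obtain ⟨α, hα, h0, hq⟩ := h
  obtain ⟨α', hα', h0', hq'⟩ := h'
  obtain ⟨y, hy⟩ := hα.exists_eq_mul hα'
  refine ⟨y, Prod.ext ?_ (Lp.ext ?_)⟩
  · rw [h0', hy, ← h0]
    rfl
  · filter_upwards [hq, hq', (conjPerp I K y).coeFn_compLp x.2] with t g g' g''
    refine Subtype.ext ?_
    have e : α' = fun s ↦ 1 * α s * (y : G) := by
      funext s
      rw [hy, one_mul]
    rw [g', e, srv_translate I 1 y.2, ← g]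
    exact (congrArg Subtype.val g'').symm

end Uniqueness

section Invariance

variable {E : Type*} [NormedAddCommGroup E] [NormedSpace ℝ E] [FiniteDimensional ℝ E]
  {H : Type*} [TopologicalSpace H] {I : ModelWithCorners ℝ E H}
  {G : Type*} [TopologicalSpace G] [ChartedSpace H G] [Group G] [LieGroup I ∞ G]
  [RiemannianBundle (fun x : G ↦ TangentSpace I x)] {K : Subgroup G} [InvariantMetric I K]

omit [FiniteDimensional ℝ E] [InvariantMetric I K]
  [RiemannianBundle (fun x : G ↦ TangentSpace I x)] in
lemma ACCurve.leftMul_leftMul (g h : G) (β : ACCurve I K) :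
    (β.leftMul h).leftMul g = β.leftMul (g * h) := by
  simp [ACCurve.leftMul, mul_smul]

omit [FiniteDimensional ℝ E] [InvariantMetric I K]
  [RiemannianBundle (fun x : G ↦ TangentSpace I x)] in
lemma ACCurve.leftMul_one (β : ACCurve I K) : β.leftMul 1 = β := by
  simp [ACCurve.leftMul]

omit [FiniteDimensional ℝ E] [InvariantMetric I K] [LieGroup I ∞ G]
  [RiemannianBundle (fun x : G ↦ TangentSpace I x)] in
lemma ACCurve.reparam_symm_reparam (γ : Reparam) (β : ACCurve I K) :
    (β.reparam γ).reparam γ.symm = β := by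
  cases β
  simp only [ACCurve.reparam, ACCurve.mk.injEq]
  funext t
  exact congrArg _ (γ.apply_symm_apply t)

omit [FiniteDimensional ℝ E] in
lemma Represents.act {x : Total I K} {β : ACCurve I K} (h : Represents x β) (y : K) :
    Represents (act x y) β := by
  simpa [SRV.act, ACCurve.leftMul_one] using h.translate 1 y

namespace TotalSymmetry

/-- The symmetry `S` induces the map `F` of curves. -/
def Lifts (S : TotalSymmetry I K) (F : ACCurve I K → ACCurve I K) : Prop :=
  ∀ x β, Represents x β → Represents (S.map x) (F β)

omit [FiniteDimensional ℝ E] in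
lemma lifts_ofLeft (g : G) : (ofLeft I K g).Lifts (ACCurve.leftMul g) := fun x β h ↦ by
  have := h.translate g 1
  rwa [conjPerp_one_compLp] at this

omit [FiniteDimensional ℝ E] in
lemma lifts_ofReparam (γ : Reparam) : (ofReparam I K γ).Lifts (ACCurve.reparam γ) :=
  fun x β h ↦ by
    simpa [map, ofReparam] using h.reparam γ

omit [FiniteDimensional ℝ E] in
lemma Lifts.thenAct {S : TotalSymmetry I K} {F : ACCurve I K → ACCurve I K} (h : S.Lifts F)
    (y : K) : (S.thenAct y).Lifts F := fun x β hx ↦ by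
  rw [map_thenAct]
  exact (h x β hx).act y

lemma Lifts.hasCurveVelocity {S : TotalSymmetry I K} {F : ACCurve I K → ACCurve I K}
    (h : S.Lifts F) {b : ℝ → ACCurve I K} {x : Total I K} {v : horizontal x}
    (hv : HasCurveVelocity b x v) :
    HasCurveVelocity (fun s ↦ F (b s)) (S.map x) (S.horizontalTangent x v) := by
  obtain ⟨c, u, hc, hu, rfl⟩ := hv
  exact ⟨_, _, hc.mono fun s hs ↦ h _ _ hs, S.hasTotalVelocity_map hu, S.horPart_tangent u⟩

omit [FiniteDimensional ℝ E] [RiemannianBundle (fun x : G ↦ TangentSpace I x)] in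
lemma mfderivWithin_translate {c : ℝ → G} {s : ℝ} (g k : G)
    (hc : MDifferentiableWithinAt 𝓘(ℝ, ℝ) I c (Set.Icc 0 1) s) (hs : s ∈ Set.Icc (0 : ℝ) 1) :
    (mfderivWithin 𝓘(ℝ, ℝ) I (fun r ↦ g * c r * k) (Set.Icc 0 1) s (1 : ℝ) : E) =
      mfderiv I I (fun z : G ↦ g * z * k) (c s)
        (mfderivWithin 𝓘(ℝ, ℝ) I c (Set.Icc 0 1) s (1 : ℝ)) := by
  have h := mfderiv_comp_mfderivWithin s (mdifferentiableAt_translate I g k (c s)) hc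
    ((uniqueDiffOn_Icc zero_lt_one).uniqueMDiffOn s hs)
  exact congrArg (fun L : ℝ →L[ℝ] E ↦ L 1) h

lemma totalVelocity_map (S : TotalSymmetry I K) {c : ℝ → Total I K} {s : ℝ}
    (h₁ : MDifferentiableWithinAt 𝓘(ℝ, ℝ) I (fun r ↦ (c r).1) (Set.Icc 0 1) s)
    (h₂ : DifferentiableWithinAt ℝ (fun r ↦ (c r).2) (Set.Icc 0 1) s)
    (hs : s ∈ Set.Icc (0 : ℝ) 1) :
    totalVelocity (fun r ↦ S.map (c r)) s = S.tangent (c s) (totalVelocity c s) := by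
  have e1 := mfderivWithin_translate (I := I) S.left S.right h₁ hs
  have e2 : derivWithin (fun r ↦ S.lin (c r).2) (Set.Icc 0 1) s =
      S.lin (derivWithin (fun r ↦ (c r).2) (Set.Icc 0 1) s) :=
    (S.lin.toContinuousLinearEquiv.hasFDerivAt.comp_hasDerivWithinAt s
      h₂.hasDerivWithinAt).derivWithin (uniqueDiffOn_Icc zero_lt_one s hs)
  exact congrArg₂ (fun (a : E) (b : L2Perp I K) ↦
    (WithLp.toLp 2 ((show TangentSpace I (S.map (c s)).1 from a), b) :
      TotalTangent (S.map (c s)))) e1 e2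

lemma Lifts.geodesicDist_le {S : TotalSymmetry I K} {F : ACCurve I K → ACCurve I K}
    (h : S.Lifts F) (β₁ β₂ : ACCurve I K) :
    geodesicDist (F β₁) (F β₂) ≤ geodesicDist β₁ β₂ := by
  unfold geodesicDist
  refine le_iInf fun c ↦ le_iInf fun h₁ ↦ le_iInf fun h₂ ↦ le_iInf fun hb₁ ↦ le_iInf fun hb₂ ↦ ?_
  have h₁' : ContMDiffOn 𝓘(ℝ, ℝ) I 1 (fun s ↦ (S.map (c s)).1) (Set.Icc 0 1) :=
    ((contMDiff_translate I S.left S.right).of_le (by simp)).comp_contMDiffOn h₁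
  have h₂' : ContDiffOn ℝ 1 (fun s ↦ (S.map (c s)).2) (Set.Icc 0 1) :=
    S.lin.toContinuousLinearEquiv.contDiff.comp_contDiffOn h₂
  have key : ∫⁻ s in Set.Icc (0 : ℝ) 1, ‖horPart (totalVelocity (fun r ↦ S.map (c r)) s)‖ₑ =
      ∫⁻ s in Set.Icc (0 : ℝ) 1, ‖horPart (totalVelocity c s)‖ₑ := by
    refine setLIntegral_congr_fun measurableSet_Icc fun s hs ↦ ?_
    have e := S.totalVelocity_map (h₁.mdifferentiableOn one_ne_zero s hs)
      (h₂.differentiableOn one_ne_zero s hs) hs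
    simp only [e, S.horPart_tangent]
    exact (S.horizontalTangent (c s)).enorm_map _
  rw [← key]
  exact iInf_le_of_le _ <| iInf_le_of_le h₁' <| iInf_le_of_le h₂' <|
    iInf_le_of_le (h _ _ hb₁) <| iInf_le_of_le (h _ _ hb₂) le_rfl

end TotalSymmetry

variable [I.Boundaryless]

lemma preservesMetric_of_lifts {S : TotalSymmetry I K} {F : ACCurve I K → ACCurve I K}
    (h : S.Lifts F) : PreservesMetric F := by
  intro β x x' hx hx'
  obtain ⟨y, hy⟩ := (h x β hx).exists_eq_act hx'
  rw [← S.map_thenAct] at hy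
  subst hy
  refine ⟨(S.thenAct y).horizontalTangent x, fun b v _ hv ↦ ?_⟩
  exact (h.thenAct y).hasCurveVelocity hv

omit [FiniteDimensional ℝ E] [I.Boundaryless] in
lemma orbitDist_act_right (x₁ x₂ : Total I K) (y : K) :
    orbitDist x₁ (act x₂ y) = orbitDist x₁ x₂ := by
  unfold orbitDist
  refine Equiv.iInf_congr (Equiv.mulLeft y) fun z ↦ ?_
  rw [act_act]
  rfl

omit [FiniteDimensional ℝ E] [I.Boundaryless] in
lemma orbitDist_act_left (x₁ x₂ : Total I K) (y : K) :
    orbitDist (act x₁ y) x₂ = orbitDist x₁ x₂ := by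
  have h := ((TotalSymmetry.ofLeft I K 1).thenAct y).orbitDist_map x₁ x₂
  rw [TotalSymmetry.map_thenAct, TotalSymmetry.map_thenAct, orbitDist_act_right] at h
  simpa [TotalSymmetry.map, TotalSymmetry.ofLeft] using h

lemma curveDist_eq_orbitDist {β₁ β₂ : ACCurve I K} {x₁ x₂ : Total I K}
    (h₁ : Represents x₁ β₁) (h₂ : Represents x₂ β₂) :
    curveDist β₁ β₂ = orbitDist x₁ x₂ := by
  unfold curveDist
  refine le_antisymm (iInf₂_le_of_le x₁ h₁ <| iInf₂_le x₂ h₂) ?_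
  refine le_iInf₂ fun z₁ hz₁ ↦ le_iInf₂ fun z₂ hz₂ ↦ ?_
  obtain ⟨y₁, rfl⟩ := h₁.exists_eq_act hz₁
  obtain ⟨y₂, rfl⟩ := h₂.exists_eq_act hz₂
  rw [orbitDist_act_left, orbitDist_act_right]

omit [FiniteDimensional ℝ E] [I.Boundaryless] in
lemma TotalSymmetry.Lifts.curveDist_le {S : TotalSymmetry I K}
    {F : ACCurve I K → ACCurve I K} (h : S.Lifts F) (β₁ β₂ : ACCurve I K) :
    curveDist (F β₁) (F β₂) ≤ curveDist β₁ β₂ := by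
  unfold curveDist
  refine le_iInf₂ fun x₁ h₁ ↦ le_iInf₂ fun x₂ h₂ ↦ ?_
  rw [← S.orbitDist_map]
  exact iInf₂_le_of_le _ (h _ _ h₁) <| iInf₂_le (S.map x₂) (h _ _ h₂)

end Invariance

end SRV

end

theorem mainTheorem5
    {E : Type*} [NormedAddCommGroup E] [NormedSpace ℝ E] [FiniteDimensional ℝ E]
    {H : Type*} [TopologicalSpace H] (I : ModelWithCorners ℝ E H) [I.Boundaryless]
    {G : Type*} [TopologicalSpace G] [ChartedSpace H G] [Group G] [LieGroup I ∞ G]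
    [RiemannianBundle (fun x : G ↦ TangentSpace I x)]
    [IsContMDiffRiemannianBundle I ∞ E (fun x : G ↦ TangentSpace I x)]
    (K : Subgroup G) (hK : IsCompact (K : Set G)) [SRV.InvariantMetric I K] :
    (∀ g : G, SRV.PreservesMetric (SRV.ACCurve.leftMul (I := I) (K := K) g)) ∧
    (∀ γ : SRV.Reparam, SRV.PreservesMetric (SRV.ACCurve.reparam (I := I) (K := K) γ)) ∧
    (∀ (β₁ β₂ : SRV.ACCurve I K) (x₁ x₂ : SRV.Total I K),
      SRV.Represents x₁ β₁ → SRV.Represents x₂ β₂ →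
      SRV.curveDist β₁ β₂ = SRV.orbitDist x₁ x₂) ∧
    (∀ (g : G) (β₁ β₂ : SRV.ACCurve I K),
      SRV.curveDist (β₁.leftMul g) (β₂.leftMul g) = SRV.curveDist β₁ β₂ ∧
      SRV.geodesicDist (β₁.leftMul g) (β₂.leftMul g) = SRV.geodesicDist β₁ β₂) ∧
    (∀ (γ : SRV.Reparam) (β₁ β₂ : SRV.ACCurve I K),
      SRV.curveDist (β₁.reparam γ) (β₂.reparam γ) = SRV.curveDist β₁ β₂ ∧
      SRV.geodesicDist (β₁.reparam γ) (β₂.reparam γ) = SRV.geodesicDist β₁ β₂) := by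
  have hl := SRV.TotalSymmetry.lifts_ofLeft (I := I) (K := K)
  have hr := SRV.TotalSymmetry.lifts_ofReparam (I := I) (K := K)
  refine ⟨fun g ↦ SRV.preservesMetric_of_lifts (hl g),
    fun γ ↦ SRV.preservesMetric_of_lifts (hr γ),
    fun _ _ _ _ h₁ h₂ ↦ SRV.curveDist_eq_orbitDist h₁ h₂, fun g β₁ β₂ ↦ ?_, fun γ β₁ β₂ ↦ ?_⟩
  · have h₁ := (hl g⁻¹).curveDist_le (β₁.leftMul g) (β₂.leftMul g)
    have h₂ := (hl g⁻¹).geodesicDist_le (β₁.leftMul g) (β₂.leftMul g)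
    simp only [SRV.ACCurve.leftMul_leftMul, inv_mul_cancel, SRV.ACCurve.leftMul_one] at h₁ h₂
    exact ⟨((hl g).curveDist_le _ _).antisymm h₁, ((hl g).geodesicDist_le _ _).antisymm h₂⟩
  · have h₁ := (hr γ.symm).curveDist_le (β₁.reparam γ) (β₂.reparam γ)
    have h₂ := (hr γ.symm).geodesicDist_le (β₁.reparam γ) (β₂.reparam γ)
    simp only [SRV.ACCurve.reparam_symm_reparam] at h₁ h₂
    exact ⟨((hr γ).curveDist_le _ _).antisymm h₁, ((hr γ).geodesicDist_le _ _).antisymm h₂⟩
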